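/- Let $1\le k<n$, put $\rho=\sqrt{2(n-k)}$, and let $\mathcal C_k=\mathbb S^{n-k}_{\rho}\times\mathbb R^{k}\subset\mathbb R^{n-k+1}\times\mathbb R^k=\mathbb R^{n+1}$ be the round cylinder, with points written $x=(\theta,y)$ and outward unit normal $\nu(x)=(\theta/|\theta|,0)$. Define the iterated exponential by $e^{\circ 0}(s)=s$, $e^{\circ N}(s)=e^{e^{\circ (N-1)}(s)}$. A rescaled mean curvature flow is a smooth family of immersed hypersurfaces with position vector $\varphi$ that moves by $(\partial_\tau \varphi)^\perp=\vec H+\tfrac12\varphi^\perp$, where $\vec H$ is the mean curvature vector and $\perp$ denotes the component normal to the hypersurface (tangential reparametrizations being immaterial). Then for every integer $N\ge 1$ there is a smooth function $u(x,\tau)>-\rho$, defined on a relatively open subset $\Omega$ of $\mathcal C_k\times\mathbb R$ that contains $$\{(x,\tau)\in\mathcal C_k\times\mathbb R:\ |y|\le e^{\circ N}(\tau),\ 0\le\tau<\infty\},$$ such that: 1. the normal graphs $M_\tau=\{x+u(x,\tau)\nu(x):(x,\tau)\in\Omega\}$ form a rescaled mean curvature flow; 2. the flow is nontrivial at every time: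 for every $\tau\ge0$ the function $u(\cdot,\tau)$ does not vanish identically on $\mathcal C_k\cap\{y=0\}$ (in particular $u\not\equiv0$); 3. it converges super-exponentially to the cylinder on the expanding region: $$\lim_{\tau\to\infty}\ \sup\{|u(x,\tau)|: x\in\mathcal C_k,\ |y|\le e^{\circ N}(\tau)\}\cdot e^{\circ N}(\tau)=0 .$$ -/

import Mathlib

open scoped ContDiff

noncomputable section

/-- The iterated exponential: `iterExp 0 x = x` and `iterExp (N + 1) x = exp (iterExp N x)`. -/
def iterExp : ℕ → ℝ → ℝ
  | 0, x => x
  | N + 1, x => Real.exp (iterExp N x)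

section MeanCurvature

variable {n : ℕ} {E : Type*} [NormedAddCommGroup E] [InnerProductSpace ℝ E]

/-- The tangent space at `F p` of the hypersurface parametrized by `F`, as a subspace of `E`. -/
def tangentSpaceOf (F : EuclideanSpace ℝ (Fin n) → E) (p : EuclideanSpace ℝ (Fin n)) :
    Submodule ℝ E :=
  LinearMap.range (fderiv ℝ F p).toLinearMap

instance (F : EuclideanSpace ℝ (Fin n) → E) (p : EuclideanSpace ℝ (Fin n)) :
    FiniteDimensional ℝ (tangentSpaceOf F p) :=
  inferInstanceAs (FiniteDimensional ℝ (LinearMap.range (fderiv ℝ F p).toLinearMap))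

/-- The component `v^⊥` of `v` that is orthogonal to the tangent space. -/
def normalPart (F : EuclideanSpace ℝ (Fin n) → E) (p : EuclideanSpace ℝ (Fin n)) (v : E) : E :=
  v - (tangentSpaceOf F p).starProjection v

/-- The induced metric `g_ij = ⟨∂_i F, ∂_j F⟩`. -/
def inducedMetric (F : EuclideanSpace ℝ (Fin n) → E) (p : EuclideanSpace ℝ (Fin n)) :
    Matrix (Fin n) (Fin n) ℝ :=
  Matrix.of fun i j =>
    inner ℝ (fderiv ℝ F p (EuclideanSpace.single i 1)) (fderiv ℝ F p (EuclideanSpace.single j 1))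

/-- The mean curvature vector `H = g^{ij} (∂_i ∂_j F)^⊥` of an immersion `F`. -/
def meanCurvatureVector (F : EuclideanSpace ℝ (Fin n) → E) (p : EuclideanSpace ℝ (Fin n)) : E :=
  ∑ i, ∑ j, (inducedMetric F p)⁻¹ i j •
    normalPart F p
      (fderiv ℝ (fderiv ℝ F) p (EuclideanSpace.single i 1) (EuclideanSpace.single j 1))

/-- `ψ` restricted to the open set `W` is a smooth local parametrization (by `n` parameters) of
the subset `S` of `E`. -/
structure IsLocalParam (S : Set E) (ψ : EuclideanSpace ℝ (Fin n) → E)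
    (W : Set (EuclideanSpace ℝ (Fin n))) : Prop where
  isOpen : IsOpen W
  smooth : ContDiffOn ℝ ∞ ψ W
  immersion : ∀ p ∈ W, Function.Injective (fderiv ℝ ψ p)
  mapsTo : Set.MapsTo ψ W S

/-- Let `S` be an `n`-dimensional submanifold of `E` and `O` an open set of space-time.
`Φ`, restricted to the points `(x, τ) ∈ O` with `x ∈ S`, is a rescaled mean curvature flow:
it is smooth, every `Φ (·, τ)` is an immersion, and in every local parametrization of `S` the
images move by `(∂_τ Φ)^⊥ = H + Φ^⊥ / 2`. (Only the normal part of the velocity is prescribed,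
since a graph parametrization differs from the one with normal velocity by a tangential
reparametrization; the moving hypersurface is the same.) -/
structure IsRescaledMCF (n : ℕ) (S : Set E) (O : Set (E × ℝ)) (Φ : E → ℝ → E) : Prop where
  smooth : ∀ (ψ : EuclideanSpace ℝ (Fin n) → E) (W : Set (EuclideanSpace ℝ (Fin n))),
    IsLocalParam S ψ W → ∀ p ∈ W, ∀ τ : ℝ, (ψ p, τ) ∈ O →
      ContDiffAt ℝ ∞ (fun z : EuclideanSpace ℝ (Fin n) × ℝ => Φ (ψ z.1) z.2) (p, τ)
  immersion : ∀ (ψ : EuclideanSpace ℝ (Fin n) → E) (W : Set (EuclideanSpace ℝ (Fin n))),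
    IsLocalParam S ψ W → ∀ p ∈ W, ∀ τ : ℝ, (ψ p, τ) ∈ O →
      Function.Injective (fderiv ℝ (fun q => Φ (ψ q) τ) p)
  equation : ∀ (ψ : EuclideanSpace ℝ (Fin n) → E) (W : Set (EuclideanSpace ℝ (Fin n))),
    IsLocalParam S ψ W → ∀ p ∈ W, ∀ τ : ℝ, (ψ p, τ) ∈ O →
      normalPart (fun q => Φ (ψ q) τ) p (deriv (fun s => Φ (ψ p) s) τ) =
        meanCurvatureVector (fun q => Φ (ψ q) τ) p +
          (1 / 2 : ℝ) • normalPart (fun q => Φ (ψ q) τ) p (Φ (ψ p) τ)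

end MeanCurvature

/-- Euclidean space `ℝ^{m+1} × ℝ^k = ℝ^{m+k+1}`, with the Euclidean norm. -/
abbrev SplitSpace (m k : ℕ) : Type :=
  WithLp 2 (EuclideanSpace ℝ (Fin (m + 1)) × EuclideanSpace ℝ (Fin k))

/-- The radius `√(2m)` of the spherical factor `S^m`. -/
def cylRadius (m : ℕ) : ℝ := Real.sqrt (2 * m)

/-- The round cylinder `S^m_{√(2m)} × ℝ^k` in `ℝ^{m+1} × ℝ^k`. -/
def roundCylinder (m k : ℕ) : Set (SplitSpace m k) := {x | ‖x.fst‖ = cylRadius m}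

/-- The outward unit normal of the round cylinder at `x = (θ, y)`, namely `(θ / |θ|, 0)`. -/
def cylNormal {m k : ℕ} (x : SplitSpace m k) : SplitSpace m k :=
  WithLp.toLp 2 (‖x.fst‖⁻¹ • x.fst, 0)

/-- The normal graph map `x ↦ x + u(x, τ) ν(x)` over the round cylinder. -/
def normalGraph {m k : ℕ} (u : SplitSpace m k → ℝ → ℝ) (x : SplitSpace m k) (τ : ℝ) :
    SplitSpace m k :=
  x + u x τ • cylNormal x

end

/-! The solution depends on one axial coordinate `y` and on time only, so the flow becomes a scalar
equation `u_yy = (1 + u_y²)(u_τ + m/(ρ+u) - (ρ+u)/2 + y u_y/2)` with `m = n - k`. It is solved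
sideways, as in Tychonoff's example for the heat equation: `y` is the evolution variable, `u(0, τ) =
g(τ)` and `u_y(0, τ) = 0` are prescribed, and the solution is a power series in `y` whose
coefficients are functions of `τ`. No parabolic theory is used, and `g` is at our disposal.

With `v = 1/(ρ+u) - 1/ρ` as a second unknown the system is polynomial, hence has a formal solution
(`picardStep_formalSol`, `formalSol_inverse`). Convergence comes from a majorant method in which one
`τ`-derivative counts as two `y`-derivatives (`maj_formalSol`). The data may then have `i`-th
derivatives as large as `(2i)!`. Analytic data have only `i!`, and the spare factorial permits any
radius of convergence `b` in `y`, provided that the data are small enough in terms of `b`.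

The data are built from `exp(-e^{∘(N+2)}(τ+S))`. Near time `τ`, put `b = e^{∘N}(τ+S)` and `X =
e^{∘(N+1)}(τ+S)`. By Cauchy's estimates the data and their derivatives carry the factor
`exp(-e^X/2)`, whereas every loss is at most the exponential of a polynomial in `X`. For large `S`
the series therefore converges for `|y| < b` and its sum is at most `b⁻²` there, which gives the
expanding region and the decay (`exists_shift`, `exists_profile`). The value on `y = 0` is `g > 0`,
hence nontriviality.

The geometric half computes the normal and the mean curvature of an arbitrary immersion into `|θ| =
r(y)` from this defining equation (`rotational_geometry`) and identifies the flow equation with the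
scalar one. -/

/-! ### Formal power series whose coefficients are functions of time -/

/-- Formal power series in `y` whose coefficients are functions of `τ`. -/
abbrev TimeSeries : Type := PowerSeries (ℝ → ℝ)

namespace TimeSeries

open PowerSeries
open scoped Nat

/-- The constant series with value `c`. -/
noncomputable def const (c : ℝ) : TimeSeries := C (fun _ => c)

/-- The formal derivative in `y`. -/
noncomputable def dy (f : TimeSeries) : TimeSeries := PowerSeries.derivative (ℝ → ℝ) f

/-- The coefficientwise derivative in `τ`. -/
noncomputable def dt (f : TimeSeries) : TimeSeries := PowerSeries.mk fun j => deriv (coeff j f)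

/-- The formal antiderivative in `y` without constant term. -/
noncomputable def yint (f : TimeSeries) : TimeSeries :=
  PowerSeries.mk fun j => match j with
    | 0 => 0
    | j + 1 => fun τ => coeff j f τ / (j + 1)

@[simp] lemma coeff_dy (f : TimeSeries) (j : ℕ) (τ : ℝ) :
    coeff j (dy f) τ = (j + 1) * coeff (j + 1) f τ := by
  simp [dy, PowerSeries.coeff_derivative, mul_comm]

lemma coeff_dy' (f : TimeSeries) (j : ℕ) :
    coeff j (dy f) = fun τ => ((j : ℝ) + 1) * coeff (j + 1) f τ := by
  ext τ; simp

@[simp] lemma coeff_dt (f : TimeSeries) (j : ℕ) : coeff j (dt f) = deriv (coeff j f) := by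
  simp [dt]

@[simp] lemma coeff_zero_yint (f : TimeSeries) : coeff 0 (yint f) = 0 := by
  simp [yint, PowerSeries.coeff_mk]

@[simp] lemma coeff_succ_yint (f : TimeSeries) (j : ℕ) :
    coeff (j + 1) (yint f) = fun τ => coeff j f τ / (j + 1) := by
  simp [yint, PowerSeries.coeff_mk]

lemma dy_yint (f : TimeSeries) : dy (yint f) = f := by
  ext j τ
  have : (j : ℝ) + 1 ≠ 0 := by positivity
  simp only [coeff_dy, coeff_succ_yint]
  field_simp

lemma dy_C (g : ℝ → ℝ) : dy (C g) = 0 := by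
  simp [dy]

lemma dy_add (f g : TimeSeries) : dy (f + g) = dy f + dy g := by simp [dy]

lemma dy_sub (f g : TimeSeries) : dy (f - g) = dy f - dy g := by simp [dy]

lemma dy_mul (f g : TimeSeries) : dy (f * g) = f * dy g + dy f * g := by
  simp only [dy, Derivation.leibniz, smul_eq_mul]; ring

/-- All coefficients are smooth. -/
def SmoothCoeffs (f : TimeSeries) : Prop := ∀ j, ContDiff ℝ ∞ (coeff j f)

namespace SmoothCoeffs

variable {f g : TimeSeries}

lemma C {g : ℝ → ℝ} (hg : ContDiff ℝ ∞ g) : SmoothCoeffs (C g) := by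
  intro j
  rw [PowerSeries.coeff_C]
  split_ifs
  · exact hg
  · exact contDiff_const

lemma const (c : ℝ) : SmoothCoeffs (const c) := SmoothCoeffs.C contDiff_const

lemma add (hf : SmoothCoeffs f) (hg : SmoothCoeffs g) : SmoothCoeffs (f + g) := by
  intro j
  rw [map_add]
  exact (hf j).add (hg j)

lemma sub (hf : SmoothCoeffs f) (hg : SmoothCoeffs g) : SmoothCoeffs (f - g) := by
  intro j
  rw [map_sub]
  exact (hf j).sub (hg j)

lemma mul (hf : SmoothCoeffs f) (hg : SmoothCoeffs g) : SmoothCoeffs (f * g) := by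
  intro j
  rw [PowerSeries.coeff_mul]
  have : (∑ p ∈ Finset.HasAntidiagonal.antidiagonal j, coeff p.1 f * coeff p.2 g)
      = fun τ => ∑ p ∈ Finset.HasAntidiagonal.antidiagonal j, coeff p.1 f τ * coeff p.2 g τ := by
    ext τ; simp [Finset.sum_apply]
  rw [this]
  exact ContDiff.sum fun p _ => (hf p.1).mul (hg p.2)

lemma X : SmoothCoeffs X := by
  intro j
  rw [PowerSeries.coeff_X]
  split_ifs <;> exact contDiff_const

lemma one : SmoothCoeffs 1 := by
  intro j
  rw [PowerSeries.coeff_one]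
  split_ifs <;> exact contDiff_const

lemma dy (hf : SmoothCoeffs f) : SmoothCoeffs (dy f) := by
  intro j
  rw [coeff_dy']
  exact contDiff_const.mul (hf _)

lemma dt (hf : SmoothCoeffs f) : SmoothCoeffs (dt f) := by
  intro j
  rw [coeff_dt]
  exact (contDiff_infty_iff_deriv.1 (hf j)).2

lemma yint (hf : SmoothCoeffs f) : SmoothCoeffs (yint f) := by
  intro j
  cases j with
  | zero => rw [coeff_zero_yint]; exact contDiff_const
  | succ j => rw [coeff_succ_yint]; exact (hf j).div_const _

end SmoothCoeffs

/-- The coefficients of index less than `n` agree. -/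
def AgreeBelow (n : ℕ) (f g : TimeSeries) : Prop := ∀ j < n, coeff j f = coeff j g

namespace AgreeBelow

variable {n : ℕ} {f g f' g' : TimeSeries}

lemma refl (n : ℕ) (f : TimeSeries) : AgreeBelow n f f := fun _ _ => rfl

lemma mono {k : ℕ} (h : AgreeBelow n f g) (hk : k ≤ n) : AgreeBelow k f g :=
  fun j hj => h j (hj.trans_le hk)

lemma trans {k : TimeSeries} (h : AgreeBelow n f g) (h' : AgreeBelow n g k) : AgreeBelow n f k :=
  fun j hj => (h j hj).trans (h' j hj)

lemma symm (h : AgreeBelow n f g) : AgreeBelow n g f := fun j hj => (h j hj).symm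

lemma add (h : AgreeBelow n f g) (h' : AgreeBelow n f' g') : AgreeBelow n (f + f') (g + g') := by
  intro j hj
  rw [map_add, map_add, h j hj, h' j hj]

lemma sub (h : AgreeBelow n f g) (h' : AgreeBelow n f' g') : AgreeBelow n (f - f') (g - g') := by
  intro j hj
  rw [map_sub, map_sub, h j hj, h' j hj]

lemma mul (h : AgreeBelow n f g) (h' : AgreeBelow n f' g') : AgreeBelow n (f * f') (g * g') := by
  intro j hj
  rw [PowerSeries.coeff_mul, PowerSeries.coeff_mul]
  refine Finset.sum_congr rfl fun p hp => ?_
  have := Finset.HasAntidiagonal.mem_antidiagonal.1 hp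
  rw [h p.1 (by omega), h' p.2 (by omega)]

lemma dy (h : AgreeBelow (n + 1) f g) : AgreeBelow n (dy f) (dy g) := by
  intro j hj
  rw [coeff_dy', coeff_dy', h (j + 1) (by omega)]

lemma dt (h : AgreeBelow n f g) : AgreeBelow n (dt f) (dt g) := by
  intro j hj
  rw [coeff_dt, coeff_dt, h j hj]

lemma yint (h : AgreeBelow n f g) : AgreeBelow (n + 1) (yint f) (yint g) := by
  intro j hj
  cases j with
  | zero => simp
  | succ j => rw [coeff_succ_yint, coeff_succ_yint, h j (by omega)]

end AgreeBelow

/-! ### The sideways Cauchy problem and its formal solution -/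

/-- The right-hand side `(1 + u_y²) (u_τ + m v - u / 2 + y u_y / 2)`. -/
noncomputable def graphRHS (m : ℝ) (u v : TimeSeries) : TimeSeries :=
  (1 + dy u * dy u) * (dt u + const m * v - const (1 / 2) * u + const (1 / 2) * (X * dy u))

/-- One step of the Picard iteration for the system `u_yy = graphRHS m u v`,
`v_y = -(ρ⁻¹ + v)² u_y` with `u = g`, `u_y = 0` and `v = h` at `y = 0`. -/
noncomputable def picardStep (m ρ : ℝ) (g h : ℝ → ℝ) (x : TimeSeries × TimeSeries) :
    TimeSeries × TimeSeries :=
  (C g + yint (yint (graphRHS m x.1 x.2)),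
    C h - yint ((const ρ⁻¹ + x.2) * (const ρ⁻¹ + x.2) * dy x.1))

/-- The Picard iterates. -/
noncomputable def picardIter (m ρ : ℝ) (g h : ℝ → ℝ) (k : ℕ) : TimeSeries × TimeSeries :=
  (picardStep m ρ g h)^[k] (C g, 0)

/-- Agreement of the first component below `n + 1` and of the second one below `n`. -/
def PairAgree (n : ℕ) (x x' : TimeSeries × TimeSeries) : Prop :=
  AgreeBelow (n + 1) x.1 x'.1 ∧ AgreeBelow n x.2 x'.2

/-- The right-hand sides involve `u_y`, `v` and `u_τ`, and `τ`-derivatives do not shift the index.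
If `u` is known below `n + 1`, then `u_y` is known below `n`, exactly as far as `v`. The double
integral for `u` then gains two indices and the single one for `v` gains one, so the offset between
the components persists. -/
lemma PairAgree.picardStep {m ρ : ℝ} {g h : ℝ → ℝ} {n : ℕ} {x x' : TimeSeries × TimeSeries}
    (hx : PairAgree n x x') :
    PairAgree (n + 1) (picardStep m ρ g h x) (picardStep m ρ g h x') := by
  obtain ⟨hu, hv⟩ := hx
  have hu' : AgreeBelow n x.1 x'.1 := hu.mono (Nat.le_succ n)
  have hR : AgreeBelow n (graphRHS m x.1 x.2) (graphRHS m x'.1 x'.2) :=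
    ((AgreeBelow.refl n 1).add (hu.dy.mul hu.dy)).mul
      (((hu'.dt.add ((AgreeBelow.refl n _).mul hv)).sub ((AgreeBelow.refl n _).mul hu')).add
        ((AgreeBelow.refl n _).mul ((AgreeBelow.refl n _).mul hu.dy)))
  have hq : AgreeBelow n (const ρ⁻¹ + x.2) (const ρ⁻¹ + x'.2) := (AgreeBelow.refl n _).add hv
  exact ⟨(AgreeBelow.refl _ _).add hR.yint.yint,
    (AgreeBelow.refl _ _).sub ((hq.mul hq).mul hu.dy).yint⟩

lemma picardIter_succ (m ρ : ℝ) (g h : ℝ → ℝ) (k : ℕ) :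
    picardIter m ρ g h (k + 1) = picardStep m ρ g h (picardIter m ρ g h k) :=
  Function.iterate_succ_apply' _ _ _

lemma pairAgree_picardIter_succ (m ρ : ℝ) (g h : ℝ → ℝ) (k : ℕ) :
    PairAgree k (picardIter m ρ g h k) (picardIter m ρ g h (k + 1)) := by
  induction k with
  | zero =>
    refine ⟨fun j hj => ?_, fun j hj => absurd hj (Nat.not_lt_zero j)⟩
    obtain rfl : j = 0 := by omega
    rw [picardIter_succ]
    simp only [picardIter, TimeSeries.picardStep, map_add, coeff_zero_yint, add_zero,
      Function.iterate_zero, id_eq]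
  | succ k ih =>
    rw [picardIter_succ _ _ _ _ (k + 1), picardIter_succ _ _ _ _ k]
    rw [picardIter_succ] at ih
    exact ih.picardStep

lemma pairAgree_picardIter_add (m ρ : ℝ) (g h : ℝ → ℝ) (k l : ℕ) :
    PairAgree k (picardIter m ρ g h k) (picardIter m ρ g h (k + l)) := by
  induction l with
  | zero => exact ⟨AgreeBelow.refl _ _, AgreeBelow.refl _ _⟩
  | succ l ih =>
    have := pairAgree_picardIter_succ m ρ g h (k + l)
    exact ⟨ih.1.trans (this.1.mono (by omega)), ih.2.trans (this.2.mono (by omega))⟩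

/-- The formal solution: the coefficientwise limit of the Picard iterates. -/
noncomputable def formalSol (m ρ : ℝ) (g h : ℝ → ℝ) : TimeSeries × TimeSeries :=
  (PowerSeries.mk fun j => coeff j (picardIter m ρ g h j).1,
    PowerSeries.mk fun j => coeff j (picardIter m ρ g h (j + 1)).2)

lemma coeff_formalSol_fst (m ρ : ℝ) (g h : ℝ → ℝ) (j : ℕ) :
    coeff j (formalSol m ρ g h).1 = coeff j (picardIter m ρ g h j).1 := by
  simp [formalSol]

lemma coeff_formalSol_snd (m ρ : ℝ) (g h : ℝ → ℝ) (j : ℕ) :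
    coeff j (formalSol m ρ g h).2 = coeff j (picardIter m ρ g h (j + 1)).2 := by
  simp [formalSol]

lemma pairAgree_formalSol (m ρ : ℝ) (g h : ℝ → ℝ) (k : ℕ) :
    PairAgree k (picardIter m ρ g h k) (formalSol m ρ g h) := by
  constructor
  · intro j hj
    obtain ⟨l, rfl⟩ := Nat.exists_eq_add_of_le (Nat.lt_succ_iff.1 hj)
    rw [coeff_formalSol_fst]
    exact ((pairAgree_picardIter_add m ρ g h j l).1 j (Nat.lt_succ_self j)).symm
  · intro j hj
    obtain ⟨l, rfl⟩ := Nat.exists_eq_add_of_le (Nat.succ_le_of_lt hj)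
    rw [coeff_formalSol_snd]
    exact ((pairAgree_picardIter_add m ρ g h (j + 1) l).2 j (Nat.lt_succ_self j)).symm

/-- Each side agrees with the iterate `k + 1` to order `k + 1`, for every `k`. -/
theorem picardStep_formalSol (m ρ : ℝ) (g h : ℝ → ℝ) :
    picardStep m ρ g h (formalSol m ρ g h) = formalSol m ρ g h := by
  have key : ∀ k, PairAgree (k + 1) (picardStep m ρ g h (formalSol m ρ g h))
      (formalSol m ρ g h) := by
    intro k
    have h1 := (pairAgree_formalSol m ρ g h k).picardStep (m := m) (ρ := ρ) (g := g) (h := h)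
    rw [← picardIter_succ] at h1
    have h2 := pairAgree_formalSol m ρ g h (k + 1)
    exact ⟨h1.1.symm.trans h2.1, h1.2.symm.trans h2.2⟩
  refine Prod.ext ?_ ?_
  · exact PowerSeries.ext fun j => (key j).1 j (by omega)
  · exact PowerSeries.ext fun j => (key j).2 j (by omega)

section FormalSol

variable {m ρ : ℝ} {g h : ℝ → ℝ}

lemma formalSol_fst_eq : (formalSol m ρ g h).1 =
    C g + yint (yint (graphRHS m (formalSol m ρ g h).1 (formalSol m ρ g h).2)) := by
  conv_lhs => rw [← picardStep_formalSol]
  rfl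

lemma formalSol_snd_eq : (formalSol m ρ g h).2 =
    C h - yint ((const ρ⁻¹ + (formalSol m ρ g h).2) * (const ρ⁻¹ + (formalSol m ρ g h).2) *
      dy (formalSol m ρ g h).1) := by
  conv_lhs => rw [← picardStep_formalSol]
  rfl

lemma dy_dy_formalSol_fst : dy (dy (formalSol m ρ g h).1) =
    graphRHS m (formalSol m ρ g h).1 (formalSol m ρ g h).2 := by
  conv_lhs => rw [formalSol_fst_eq]
  rw [dy_add, dy_C, zero_add, dy_yint, dy_yint]

lemma dy_formalSol_snd : dy (formalSol m ρ g h).2 =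
    -((const ρ⁻¹ + (formalSol m ρ g h).2) * (const ρ⁻¹ + (formalSol m ρ g h).2) *
      dy (formalSol m ρ g h).1) := by
  conv_lhs => rw [formalSol_snd_eq]
  rw [dy_sub, dy_C, dy_yint, zero_sub]

lemma coeff_zero_formalSol_fst : coeff 0 (formalSol m ρ g h).1 = g := by
  rw [formalSol_fst_eq, map_add, coeff_zero_yint]
  simp

lemma coeff_zero_formalSol_snd : coeff 0 (formalSol m ρ g h).2 = h := by
  rw [formalSol_snd_eq, map_sub, coeff_zero_yint]
  simp

/-- A formal solution of a linear homogeneous equation with zero initial value vanishes. -/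
lemma eq_zero_of_dy_eq_mul {c e : TimeSeries} (he : dy e = c * e) (h0 : coeff 0 e = 0) :
    e = 0 := by
  refine PowerSeries.ext fun j => ?_
  rw [map_zero]
  induction j using Nat.strong_induction_on with
  | _ j ih =>
    cases j with
    | zero => exact h0
    | succ j =>
      ext τ
      have h1 : coeff j (dy e) τ = coeff j (c * e) τ := by rw [he]
      rw [coeff_dy, PowerSeries.coeff_mul, Finset.sum_eq_zero] at h1
      · have : (j : ℝ) + 1 ≠ 0 := by positivity
        simpa [this] using h1
      · intro p hp
        have := Finset.HasAntidiagonal.mem_antidiagonal.1 hp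
        rw [ih p.2 (by omega), mul_zero]

/-- The second component is the deviation of the reciprocal radius. -/
lemma formalSol_inverse (hgh : ∀ τ, (ρ⁻¹ + h τ) * (ρ + g τ) = 1) :
    (const ρ⁻¹ + (formalSol m ρ g h).2) * (const ρ + (formalSol m ρ g h).1) = 1 := by
  set u := (formalSol m ρ g h).1 with hu
  set v := (formalSol m ρ g h).2 with hv
  have hdv : dy v = -((const ρ⁻¹ + v) * (const ρ⁻¹ + v) * dy u) := dy_formalSol_snd
  have hone : dy (1 : TimeSeries) = 0 := by simp [dy]
  -- The defect `e = 1 - (ρ⁻¹ + v)(ρ + u)` satisfies `e_y = -(ρ⁻¹ + v) u_y e`, and it vanishes at `y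
  -- = 0` because the data are reciprocal to each other.
  have : 1 - (const ρ⁻¹ + v) * (const ρ + u) = 0 := by
    refine eq_zero_of_dy_eq_mul (c := -((const ρ⁻¹ + v) * dy u)) ?_ ?_
    · rw [dy_sub, dy_mul, dy_add, dy_add, const, const, dy_C, dy_C, hdv, hone]
      simp only [const]
      ring
    · ext τ
      have hu0 : coeff 0 u = g := coeff_zero_formalSol_fst
      have hv0 : coeff 0 v = h := coeff_zero_formalSol_snd
      rw [PowerSeries.coeff_zero_eq_constantCoeff] at hu0 hv0 ⊢
      simp [hu0, hv0, const, hgh τ]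
  exact (sub_eq_zero.1 this).symm

end FormalSol

lemma SmoothCoeffs.graphRHS {m : ℝ} {u v : TimeSeries} (hu : SmoothCoeffs u)
    (hv : SmoothCoeffs v) : SmoothCoeffs (graphRHS m u v) :=
  (SmoothCoeffs.one.add (hu.dy.mul hu.dy)).mul
    (((hu.dt.add ((SmoothCoeffs.const _).mul hv)).sub ((SmoothCoeffs.const _).mul hu)).add
      ((SmoothCoeffs.const _).mul (SmoothCoeffs.X.mul hu.dy)))

lemma smoothCoeffs_picardIter {m ρ : ℝ} {g h : ℝ → ℝ} (hg : ContDiff ℝ ∞ g)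
    (hh : ContDiff ℝ ∞ h) (k : ℕ) :
    SmoothCoeffs (picardIter m ρ g h k).1 ∧ SmoothCoeffs (picardIter m ρ g h k).2 := by
  induction k with
  | zero => exact ⟨SmoothCoeffs.C hg, fun j => by
      change ContDiff ℝ ∞ (coeff j (0 : TimeSeries))
      rw [map_zero]
      exact contDiff_const⟩
  | succ k ih =>
    rw [picardIter_succ]
    obtain ⟨hu, hv⟩ := ih
    have hq := (SmoothCoeffs.const ρ⁻¹).add hv
    exact ⟨(SmoothCoeffs.C hg).add (hu.graphRHS hv).yint.yint,
      (SmoothCoeffs.C hh).sub ((hq.mul hq).mul hu.dy).yint⟩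

lemma smoothCoeffs_formalSol {m ρ : ℝ} {g h : ℝ → ℝ} (hg : ContDiff ℝ ∞ g)
    (hh : ContDiff ℝ ∞ h) :
    SmoothCoeffs (formalSol m ρ g h).1 ∧ SmoothCoeffs (formalSol m ρ g h).2 := by
  refine ⟨fun j => ?_, fun j => ?_⟩
  · rw [coeff_formalSol_fst]
    exact (smoothCoeffs_picardIter hg hh j).1 j
  · rw [coeff_formalSol_snd]
    exact (smoothCoeffs_picardIter hg hh (j + 1)).2 j

/-! ### Majorants of order two in `τ` -/

/-- The square of `i.choose k` is one term of Vandermonde's sum for `(2 * i).choose (2 * k)`. -/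
lemma choose_le_choose_two_mul (i k : ℕ) : i.choose k ≤ (2 * i).choose (2 * k) := by
  rw [two_mul, two_mul, Nat.add_choose_eq]
  refine (Nat.le_mul_self _).trans ?_
  exact Finset.single_le_sum (f := fun p : ℕ × ℕ => i.choose p.1 * i.choose p.2)
    (fun _ _ => Nat.zero_le _) (Finset.HasAntidiagonal.mem_antidiagonal.2 rfl : (k, k) ∈ _)

/-- These are the multiplicities of the Leibniz rule in `(τ, y)`, collected by weighted order `l`.
After the `τ`-binomials are doubled, Vandermonde's identity for `2i + j` applies. -/
lemma sum_choose_mul_choose_le (i j l : ℕ) :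
    ∑ x ∈ Finset.range (i + 1) ×ˢ Finset.range (j + 1) with 2 * x.1 + x.2 = l,
      i.choose x.1 * j.choose x.2 ≤ (2 * i + j).choose l := by
  rw [Nat.add_choose_eq]
  set s := (Finset.range (i + 1) ×ˢ Finset.range (j + 1)).filter fun x => 2 * x.1 + x.2 = l
  calc ∑ x ∈ s, i.choose x.1 * j.choose x.2
      ≤ ∑ x ∈ s, (2 * i).choose (2 * x.1) * j.choose x.2 :=
        Finset.sum_le_sum fun x _ => Nat.mul_le_mul_right _ (choose_le_choose_two_mul i x.1)
    _ = ∑ p ∈ s.image (fun x => (2 * x.1, x.2)), (2 * i).choose p.1 * j.choose p.2 := by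
        rw [Finset.sum_image]
        intro x _ x' _ h
        simp only [Prod.mk.injEq] at h
        exact Prod.ext (by omega) h.2
    _ ≤ _ := by
        refine Finset.sum_le_sum_of_subset fun p hp => ?_
        obtain ⟨x, hx, rfl⟩ := Finset.mem_image.1 hp
        exact Finset.HasAntidiagonal.mem_antidiagonal.2 (Finset.mem_filter.1 hx).2

/-- `α` majorizes `f` at time `τ`, one derivative in `τ` being counted as two derivatives
in `y`. -/
def Maj (a b τ : ℝ) (f : TimeSeries) (α : ℕ → ℝ) : Prop :=
  ∀ i j, |iteratedDeriv i (coeff j f) τ| * j ! * a ^ i * b ^ j ≤ (2 * i + j)! * α (2 * i + j)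

/-- The Cauchy product of two sequences. -/
def conv (α χ : ℕ → ℝ) (n : ℕ) : ℝ := ∑ l ∈ Finset.range (n + 1), α l * χ (n - l)

namespace Maj

variable {a b τ : ℝ} {f g : TimeSeries} {α χ : ℕ → ℝ}

lemma mono (hf : Maj a b τ f α) (h : ∀ n, α n ≤ χ n) : Maj a b τ f χ := fun i j =>
  (hf i j).trans (mul_le_mul_of_nonneg_left (h _) (by positivity))

lemma contDiffAt (hf : SmoothCoeffs f) (i j : ℕ) : ContDiffAt ℝ i (coeff j f) τ :=
  ((hf j).of_le (by exact_mod_cast le_top)).contDiffAt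

lemma add (ha : 0 ≤ a) (hb : 0 ≤ b) (hsf : SmoothCoeffs f) (hsg : SmoothCoeffs g)
    (hf : Maj a b τ f α) (hg : Maj a b τ g χ) : Maj a b τ (f + g) (fun n => α n + χ n) := by
  intro i j
  rw [map_add, iteratedDeriv_add (contDiffAt hsf i j) (contDiffAt hsg i j)]
  calc _ ≤ (|iteratedDeriv i (coeff j f) τ| + |iteratedDeriv i (coeff j g) τ|)
        * j ! * a ^ i * b ^ j := by gcongr; exact abs_add_le _ _
    _ = |iteratedDeriv i (coeff j f) τ| * j ! * a ^ i * b ^ j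
        + |iteratedDeriv i (coeff j g) τ| * j ! * a ^ i * b ^ j := by ring
    _ ≤ _ := by rw [mul_add]; exact add_le_add (hf i j) (hg i j)

lemma neg (hf : Maj a b τ f α) : Maj a b τ (-f) α := by
  intro i j
  rw [map_neg, iteratedDeriv_neg, abs_neg]
  exact hf i j

lemma sub (ha : 0 ≤ a) (hb : 0 ≤ b) (hsf : SmoothCoeffs f) (hsg : SmoothCoeffs g)
    (hf : Maj a b τ f α) (hg : Maj a b τ g χ) : Maj a b τ (f - g) (fun n => α n + χ n) := by
  intro i j
  rw [map_sub, iteratedDeriv_sub (contDiffAt hsf i j) (contDiffAt hsg i j)]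
  calc _ ≤ (|iteratedDeriv i (coeff j f) τ| + |iteratedDeriv i (coeff j g) τ|)
        * j ! * a ^ i * b ^ j := by gcongr; exact abs_sub _ _
    _ = |iteratedDeriv i (coeff j f) τ| * j ! * a ^ i * b ^ j
        + |iteratedDeriv i (coeff j g) τ| * j ! * a ^ i * b ^ j := by ring
    _ ≤ _ := by rw [mul_add]; exact add_le_add (hf i j) (hg i j)

lemma const_mul (hsf : SmoothCoeffs f) (hf : Maj a b τ f α) (c : ℝ) :
    Maj a b τ (const c * f) (fun n => |c| * α n) := by
  intro i j
  have : coeff j (const c * f) = fun τ => c * coeff j f τ := by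
    ext τ; simp [const, PowerSeries.coeff_C_mul]
  rw [this, iteratedDeriv_const_mul c (contDiffAt hsf i j), abs_mul]
  calc _ = |c| * (|iteratedDeriv i (coeff j f) τ| * j ! * a ^ i * b ^ j) := by ring
    _ ≤ |c| * ((2 * i + j)! * α (2 * i + j)) :=
        mul_le_mul_of_nonneg_left (hf i j) (abs_nonneg c)
    _ = _ := by ring

lemma dy (hb : 0 < b) (hsf : SmoothCoeffs f) (hf : Maj a b τ f α) :
    Maj a b τ (dy f) (fun n => b⁻¹ * ((n + 1) * α (n + 1))) := by
  intro i j
  rw [coeff_dy', iteratedDeriv_const_mul _ (contDiffAt hsf i _), abs_mul]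
  have h1 := hf i (j + 1)
  rw [← add_assoc] at h1
  have h2 : |(j : ℝ) + 1| = j + 1 := abs_of_nonneg (by positivity)
  rw [Nat.factorial_succ, Nat.factorial_succ] at h1
  push_cast at h1 ⊢
  rw [h2]
  calc _ = b⁻¹ * (|iteratedDeriv i (coeff (j + 1) f) τ| * ((j + 1) * j !) * a ^ i
        * b ^ (j + 1)) := by rw [pow_succ]; field_simp
    _ ≤ b⁻¹ * _ := mul_le_mul_of_nonneg_left h1 (by positivity)
    _ = _ := by ring

/-- A `τ`-derivative raises the weighted order by two, so on majorants it acts as `a⁻¹` times the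
second derivative. Thus `u_τ` is of the same order as `u_yy`, and a large `a` makes it small in
comparison. -/
lemma dt (ha : 0 < a) (hf : Maj a b τ f α) :
    Maj a b τ (dt f) (fun n => a⁻¹ * ((n + 1) * (n + 2) * α (n + 2))) := by
  intro i j
  have h1 := hf (i + 1) j
  rw [iteratedDeriv_succ', show 2 * (i + 1) + j = 2 * i + j + 1 + 1 by ring,
    Nat.factorial_succ, Nat.factorial_succ] at h1
  rw [coeff_dt]
  push_cast at h1 ⊢
  calc _ = a⁻¹ * (|iteratedDeriv i (deriv (coeff j f)) τ| * j ! * a ^ (i + 1)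
        * b ^ j) := by rw [pow_succ]; field_simp
    _ ≤ a⁻¹ * _ := mul_le_mul_of_nonneg_left h1 (by positivity)
    _ = _ := by ring

lemma X_mul_dy (hα : ∀ n, 0 ≤ α n) (hsf : SmoothCoeffs f) (hf : Maj a b τ f α) :
    Maj a b τ (X * TimeSeries.dy f) (fun n => n * α n) := by
  intro i j
  have h1 : coeff j (X * TimeSeries.dy f) = fun τ => (j : ℝ) * coeff j f τ := by
    cases j with
    | zero => ext τ; simp
    | succ j => rw [PowerSeries.coeff_succ_X_mul, coeff_dy']; push_cast; rfl
  rw [h1, iteratedDeriv_const_mul _ (contDiffAt hsf i j), abs_mul, Nat.abs_cast]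
  have h2 := hα (2 * i + j)
  calc _ = (j : ℝ) * (|iteratedDeriv i (coeff j f) τ| * j ! * a ^ i * b ^ j) := by ring
    _ ≤ (j : ℝ) * ((2 * i + j)! * α (2 * i + j)) :=
        mul_le_mul_of_nonneg_left (hf i j) (by positivity)
    _ ≤ ((2 * i + j : ℕ) : ℝ) * ((2 * i + j)! * α (2 * i + j)) := by
        gcongr; omega
    _ = _ := by ring

/-- The initial value together with the antiderivative. -/
lemma C_add_yint (hb : 0 ≤ b) {g : ℝ → ℝ} (hf : Maj a b τ f α)
    (h0 : ∀ i, |iteratedDeriv i g τ| * a ^ i ≤ (2 * i)! * χ (2 * i))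
    (h1 : ∀ n, b * α n ≤ (n + 1) * χ (n + 1)) :
    Maj a b τ (C g + yint f) χ := by
  intro i j
  cases j with
  | zero =>
    rw [map_add, coeff_zero_yint]
    simpa using h0 i
  | succ j =>
    have h2 : coeff (j + 1) (C g + yint f) = fun τ => ((j : ℝ) + 1)⁻¹ * coeff j f τ := by
      rw [map_add, coeff_succ_yint, PowerSeries.coeff_C]
      ext τ
      simp [div_eq_inv_mul]
    have h3 : ∀ x, iteratedDeriv i (fun τ => ((j : ℝ) + 1)⁻¹ * coeff j f τ) x
        = ((j : ℝ) + 1)⁻¹ * iteratedDeriv i (coeff j f) x := by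
      intro x
      exact iteratedDeriv_const_mul_field _ _
    have h4 : |((j : ℝ) + 1)⁻¹| = ((j : ℝ) + 1)⁻¹ := abs_of_nonneg (by positivity)
    rw [h2, h3, abs_mul, h4, ← add_assoc, Nat.factorial_succ, Nat.factorial_succ]
    have h5 := h1 (2 * i + j)
    push_cast at h5 ⊢
    calc _ = b * (|iteratedDeriv i (coeff j f) τ| * j ! * a ^ i * b ^ j) := by
            rw [pow_succ]; field_simp
      _ ≤ b * ((2 * i + j)! * α (2 * i + j)) := mul_le_mul_of_nonneg_left (hf i j) hb
      _ = (2 * i + j)! * (b * α (2 * i + j)) := by ring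
      _ ≤ (2 * i + j)! * ((2 * i + j + 1) * χ (2 * i + j + 1)) := by gcongr
      _ = _ := by ring

lemma iteratedDeriv_coeff_mul (hsf : SmoothCoeffs f) (hsg : SmoothCoeffs g) (i j : ℕ) :
    iteratedDeriv i (coeff j (f * g)) τ = ∑ x ∈ Finset.range (i + 1) ×ˢ Finset.range (j + 1),
      (i.choose x.1 : ℝ) * iteratedDeriv x.1 (coeff x.2 f) τ
        * iteratedDeriv (i - x.1) (coeff (j - x.2) g) τ := by
  rw [PowerSeries.coeff_mul, iteratedDeriv_sum, Finset.sum_product_right,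
    Finset.Nat.sum_antidiagonal_eq_sum_range_succ
      (fun k l => iteratedDeriv i (coeff k f * coeff l g) τ)]
  · refine Finset.sum_congr rfl fun k _ => ?_
    exact iteratedDeriv_mul (contDiffAt hsf i k) (contDiffAt hsg i _)
  · intro p _
    exact (contDiffAt hsf i _).mul (contDiffAt hsg i _)

/-- The Leibniz terms of weighted order `l` have total multiplicity at most `n.choose l` with `n =
2i + j`. This turns the factorials `l! (n - l)!` of the two majorants into `n!`. -/
lemma mul (ha : 0 ≤ a) (hb : 0 ≤ b) (hsf : SmoothCoeffs f) (hsg : SmoothCoeffs g)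
    (hα : ∀ n, 0 ≤ α n) (hχ : ∀ n, 0 ≤ χ n)
    (hf : Maj a b τ f α) (hg : Maj a b τ g χ) : Maj a b τ (f * g) (conv α χ) := by
  intro i j
  set n := 2 * i + j with hn
  set s := Finset.range (i + 1) ×ˢ Finset.range (j + 1) with hs
  rw [iteratedDeriv_coeff_mul hsf hsg]
  have hmem : ∀ x ∈ s, x.1 ≤ i ∧ x.2 ≤ j := by
    intro x hx
    rw [hs, Finset.mem_product, Finset.mem_range, Finset.mem_range] at hx
    omega
  calc _ ≤ (∑ x ∈ s, |(i.choose x.1 : ℝ) * iteratedDeriv x.1 (coeff x.2 f) τ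
        * iteratedDeriv (i - x.1) (coeff (j - x.2) g) τ|) * j ! * a ^ i * b ^ j := by
        gcongr; exact Finset.abs_sum_le_sum_abs _ _
    _ = ∑ x ∈ s, |(i.choose x.1 : ℝ) * iteratedDeriv x.1 (coeff x.2 f) τ
        * iteratedDeriv (i - x.1) (coeff (j - x.2) g) τ| * j ! * a ^ i * b ^ j := by
        rw [Finset.sum_mul, Finset.sum_mul, Finset.sum_mul]
    _ ≤ ∑ x ∈ s, ((i.choose x.1 * j.choose x.2 : ℕ) : ℝ) *
        ((2 * x.1 + x.2)! * (n - (2 * x.1 + x.2))! *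
          (α (2 * x.1 + x.2) * χ (n - (2 * x.1 + x.2)))) := by
        refine Finset.sum_le_sum fun x hx => ?_
        obtain ⟨h1, h2⟩ := hmem x hx
        have h3 := hf x.1 x.2
        have h4 := hg (i - x.1) (j - x.2)
        rw [show 2 * (i - x.1) + (j - x.2) = n - (2 * x.1 + x.2) by omega] at h4
        have h5 : (j ! : ℝ) = j.choose x.2 * x.2 ! * (j - x.2)! := by
          rw [← Nat.choose_mul_factorial_mul_factorial h2]; push_cast; ring
        have h6 : a ^ i = a ^ x.1 * a ^ (i - x.1) := by rw [← pow_add]; congr 1; omega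
        have h7 : b ^ j = b ^ x.2 * b ^ (j - x.2) := by rw [← pow_add]; congr 1; omega
        rw [abs_mul, abs_mul, Nat.abs_cast, h5, h6, h7]
        push_cast
        have h8 := hα (2 * x.1 + x.2)
        calc _ = ((i.choose x.1 : ℝ) * j.choose x.2) *
              ((|iteratedDeriv x.1 (coeff x.2 f) τ| * x.2 ! * a ^ x.1 * b ^ x.2) *
              (|iteratedDeriv (i - x.1) (coeff (j - x.2) g) τ| * (j - x.2)! * a ^ (i - x.1)
                * b ^ (j - x.2))) := by ring
          _ ≤ ((i.choose x.1 : ℝ) * j.choose x.2) *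
              (((2 * x.1 + x.2)! * α (2 * x.1 + x.2)) *
                ((n - (2 * x.1 + x.2))! * χ (n - (2 * x.1 + x.2)))) := by
              gcongr
          _ = _ := by ring
    _ = ∑ l ∈ Finset.range (n + 1), ∑ x ∈ s with 2 * x.1 + x.2 = l,
        ((i.choose x.1 * j.choose x.2 : ℕ) : ℝ) *
        ((2 * x.1 + x.2)! * (n - (2 * x.1 + x.2))! *
          (α (2 * x.1 + x.2) * χ (n - (2 * x.1 + x.2)))) := by
        rw [Finset.sum_fiberwise_of_maps_to]
        intro x hx
        have := hmem x hx
        rw [Finset.mem_range]; omega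
    _ ≤ ∑ l ∈ Finset.range (n + 1), (n ! : ℝ) * (α l * χ (n - l)) := by
        refine Finset.sum_le_sum fun l hl => ?_
        have hl' : l ≤ n := by rw [Finset.mem_range] at hl; omega
        have h1 : (∑ x ∈ s with 2 * x.1 + x.2 = l, ((i.choose x.1 * j.choose x.2 : ℕ) : ℝ))
            ≤ n.choose l := by
          exact_mod_cast sum_choose_mul_choose_le i j l
        have h2 : (n ! : ℝ) = n.choose l * (l ! * (n - l)!) := by
          rw [← Nat.choose_mul_factorial_mul_factorial hl']; push_cast; ring
        have h3 := hα l
        have h4 := hχ (n - l)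
        calc _ = ∑ x ∈ s with 2 * x.1 + x.2 = l, ((i.choose x.1 * j.choose x.2 : ℕ) : ℝ) *
              (l ! * (n - l)! * (α l * χ (n - l))) := by
              refine Finset.sum_congr rfl fun x hx => ?_
              rw [(Finset.mem_filter.1 hx).2]
          _ = (∑ x ∈ s with 2 * x.1 + x.2 = l, ((i.choose x.1 * j.choose x.2 : ℕ) : ℝ)) *
              (l ! * (n - l)! * (α l * χ (n - l))) := by rw [Finset.sum_mul]
          _ ≤ n.choose l * (l ! * (n - l)! * (α l * χ (n - l))) := by gcongr
          _ = _ := by rw [h2]; ring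
    _ = _ := by rw [conv, Finset.mul_sum]

end Maj

/-! ### The weight sequence -/

lemma sum_inv_sq_le_two (n : ℕ) : ∑ l ∈ Finset.range n, (1 : ℝ) / (l + 1) ^ 2 ≤ 2 := by
  have key : ∀ n : ℕ, ∑ l ∈ Finset.range (n + 1), (1 : ℝ) / (l + 1) ^ 2
      ≤ (2 : ℝ) - 1 / ((n : ℝ) + 1) := by
    intro n
    induction n with
    | zero => norm_num
    | succ n ih =>
      rw [Finset.sum_range_succ]
      have : (1 : ℝ) / ((n + 1 : ℕ) + 1) ^ 2 ≤ 1 / (n + 1) - 1 / ((n + 1 : ℕ) + 1) := by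
        push_cast
        rw [div_sub_div _ _ (by positivity) (by positivity),
          div_le_div_iff₀ (by positivity) (by positivity)]
        nlinarith
      push_cast at this ⊢
      linarith
  cases n with
  | zero => norm_num
  | succ n =>
    have : (0 : ℝ) ≤ 1 / (n + 1) := by positivity
    linarith [key n]

/-- With `x = 1/(l+1)` and `y = 1/(k+1)`, where `k = n - l`, one has `(n + 2) x y = x + y`.
Convexity of the `p`-th power then splits the product into two summable pieces with the factor
`(n+1)⁻ᵖ` in front. -/
lemma sum_inv_pow_mul_inv_pow_le {p : ℕ} (hp : 2 ≤ p) (n : ℕ) :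
    ∑ l ∈ Finset.range (n + 1), (1 : ℝ) / (l + 1) ^ p * (1 / ((n - l : ℕ) + 1) ^ p)
      ≤ 2 ^ (p + 2) / (n + 1) ^ p := by
  have hterm : ∀ l ∈ Finset.range (n + 1),
      (1 : ℝ) / (l + 1) ^ p * (1 / ((n - l : ℕ) + 1) ^ p)
        ≤ 2 ^ p / (n + 1) ^ p * (1 / (l + 1) ^ 2 + 1 / ((n - l : ℕ) + 1) ^ 2) := by
    intro l hl
    have hl' : l ≤ n := by rw [Finset.mem_range] at hl; omega
    obtain ⟨k, rfl⟩ := Nat.exists_eq_add_of_le hl'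
    rw [Nat.add_sub_cancel_left]
    push_cast
    set x : ℝ := 1 / (l + 1) with hx
    set y : ℝ := 1 / (k + 1) with hy
    have hx0 : 0 ≤ x := by positivity
    have hy0 : 0 ≤ y := by positivity
    have hx1 : x ≤ 1 := by
      rw [hx, div_le_one (by positivity)]; linarith [(l.cast_nonneg : (0:ℝ) ≤ l)]
    have hy1 : y ≤ 1 := by
      rw [hy, div_le_one (by positivity)]; linarith [(k.cast_nonneg : (0:ℝ) ≤ k)]
    have h1 : ((l : ℝ) + k + 1) * (x * y) ≤ x + y := by
      have : x + y = (l + k + 2) * (x * y) := by rw [hx, hy]; field_simp; ring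
      rw [this]
      have : 0 ≤ x * y := by positivity
      nlinarith
    have h2 : (((l : ℝ) + k + 1) * (x * y)) ^ p ≤ 2 ^ p * (x ^ 2 + y ^ 2) := by
      calc _ ≤ (x + y) ^ p := by gcongr
        _ ≤ 2 ^ (p - 1) * (x ^ p + y ^ p) := add_pow_le hx0 hy0 p
        _ ≤ 2 ^ p * (x ^ 2 + y ^ 2) := by
          gcongr ?_ * (?_ + ?_)
          · exact pow_le_pow_right₀ (by norm_num) (by omega)
          · exact pow_le_pow_of_le_one hx0 hx1 hp
          · exact pow_le_pow_of_le_one hy0 hy1 hp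
    have h3 : (1 : ℝ) / (l + 1) ^ p * (1 / (k + 1) ^ p) = (x * y) ^ p := by
      rw [hx, hy, mul_pow, div_pow, div_pow, one_pow]
    have h4 : (1 : ℝ) / (l + 1) ^ 2 + 1 / (k + 1) ^ 2 = x ^ 2 + y ^ 2 := by
      rw [hx, hy, div_pow, div_pow, one_pow]
    rw [h3, h4, div_mul_eq_mul_div (2 ^ p), le_div_iff₀ (by positivity)]
    calc _ = (((l : ℝ) + k + 1) * (x * y)) ^ p := by rw [mul_pow _ (x * y)]; ring
      _ ≤ _ := h2
  have hrefl : ∑ l ∈ Finset.range (n + 1), (1 : ℝ) / ((n - l : ℕ) + 1) ^ 2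
      = ∑ l ∈ Finset.range (n + 1), (1 : ℝ) / (l + 1) ^ 2 := by
    rw [← Finset.sum_range_reflect (fun l => (1 : ℝ) / (l + 1) ^ 2)]
    simp
  calc _ ≤ ∑ l ∈ Finset.range (n + 1), (2 : ℝ) ^ p / (n + 1) ^ p *
        (1 / (l + 1) ^ 2 + 1 / ((n - l : ℕ) + 1) ^ 2) := Finset.sum_le_sum hterm
    _ = (2 : ℝ) ^ p / (n + 1) ^ p * (∑ l ∈ Finset.range (n + 1), (1 : ℝ) / (l + 1) ^ 2 +
        ∑ l ∈ Finset.range (n + 1), (1 : ℝ) / (l + 1) ^ 2) := by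
        rw [← Finset.mul_sum, Finset.sum_add_distrib, hrefl]
    _ ≤ (2 : ℝ) ^ p / (n + 1) ^ p * (2 + 2) := by
        gcongr <;> exact sum_inv_sq_le_two _
    _ = _ := by rw [pow_add]; ring

/-- The initially growing factor of the weights. -/
noncomputable def growth (L n : ℕ) : ℝ := (L : ℝ) ^ min n L

/-- The weights `L ^ min n L / (n + 1) ^ 4`. -/
noncomputable def weight (L n : ℕ) : ℝ := growth L n / (n + 1) ^ 4

/-- The coefficients of the first derivative of the weight series. -/
noncomputable def weight₁ (L n : ℕ) : ℝ := (n + 1) * weight L (n + 1)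

/-- The coefficients of the second derivative of the weight series. -/
noncomputable def weight₂ (L n : ℕ) : ℝ := (n + 1) * (n + 2) * weight L (n + 2)

section Weight

variable {L : ℕ}

lemma growth_nonneg (L n : ℕ) : 0 ≤ growth L n := by unfold growth; positivity

lemma one_le_growth (hL : 1 ≤ L) (n : ℕ) : 1 ≤ growth L n :=
  one_le_pow₀ (by exact_mod_cast hL)

lemma growth_mono (hL : 1 ≤ L) {k n : ℕ} (h : k ≤ n) : growth L k ≤ growth L n :=
  pow_le_pow_right₀ (by exact_mod_cast hL) (by omega)

lemma growth_add_le (hL : 1 ≤ L) (k n : ℕ) : growth L (n + k) ≤ L ^ k * growth L n := by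
  unfold growth
  rw [← pow_add]
  exact pow_le_pow_right₀ (by exact_mod_cast hL) (by omega)

lemma growth_le (hL : 1 ≤ L) (n : ℕ) : growth L n ≤ (L : ℝ) ^ L :=
  pow_le_pow_right₀ (by exact_mod_cast hL) (by omega)

/-- In exponents, `min l L + min (n - l) L ≤ L + min n L`. The loss `L ^ L` in products is
compensated later by the smallness of the majorant size `M`. -/
lemma growth_mul_le (hL : 1 ≤ L) {l n : ℕ} (h : l ≤ n) :
    growth L l * growth L (n - l) ≤ (L : ℝ) ^ L * growth L n := by
  unfold growth
  rw [← pow_add, ← pow_add]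
  exact pow_le_pow_right₀ (by exact_mod_cast hL) (by omega)

lemma weight_nonneg (L n : ℕ) : 0 ≤ weight L n :=
  div_nonneg (growth_nonneg L n) (by positivity)

lemma weight₁_nonneg (L n : ℕ) : 0 ≤ weight₁ L n :=
  mul_nonneg (by positivity) (weight_nonneg L _)

lemma weight₂_nonneg (L n : ℕ) : 0 ≤ weight₂ L n :=
  mul_nonneg (by positivity) (weight_nonneg L _)

lemma conv_growth_le (hL : 1 ≤ L) {p : ℕ} (hp : 2 ≤ p) {A B : ℝ} (hA : 0 ≤ A) (hB : 0 ≤ B)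
    {α χ : ℕ → ℝ} (hχ0 : ∀ n, 0 ≤ χ n)
    (hα : ∀ n, α n ≤ A * (growth L n / (n + 1) ^ p))
    (hχ : ∀ n, χ n ≤ B * (growth L n / (n + 1) ^ p)) (n : ℕ) :
    conv α χ n ≤ 2 ^ (p + 2) * (A * B) * L ^ L * (growth L n / (n + 1) ^ p) := by
  have hg := growth_nonneg L
  calc conv α χ n ≤ ∑ l ∈ Finset.range (n + 1), (A * B * L ^ L * growth L n) *
        ((1 : ℝ) / (l + 1) ^ p * (1 / ((n - l : ℕ) + 1) ^ p)) := by
        refine Finset.sum_le_sum fun l hl => ?_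
        have hl' : l ≤ n := by rw [Finset.mem_range] at hl; omega
        have h1 := hg l
        have h2 := hg (n - l)
        calc α l * χ (n - l) ≤ (A * (growth L l / (l + 1) ^ p)) *
              (B * (growth L (n - l) / ((n - l : ℕ) + 1) ^ p)) :=
              mul_le_mul (hα l) (hχ _) (hχ0 _) (by positivity)
          _ = (A * B) * (growth L l * growth L (n - l)) *
              ((1 : ℝ) / (l + 1) ^ p * (1 / ((n - l : ℕ) + 1) ^ p)) := by ring
          _ ≤ (A * B) * (L ^ L * growth L n) *
              ((1 : ℝ) / (l + 1) ^ p * (1 / ((n - l : ℕ) + 1) ^ p)) := by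
              gcongr ?_ * ?_ * _
              exact growth_mul_le hL hl'
          _ = _ := by ring
    _ = (A * B * L ^ L * growth L n) * ∑ l ∈ Finset.range (n + 1),
        ((1 : ℝ) / (l + 1) ^ p * (1 / ((n - l : ℕ) + 1) ^ p)) := by rw [Finset.mul_sum]
    _ ≤ (A * B * L ^ L * growth L n) * (2 ^ (p + 2) / (n + 1) ^ p) := by
        have := hg n
        gcongr
        exact sum_inv_pow_mul_inv_pow_le hp n
    _ = _ := by ring

lemma weight_le_cube (n : ℕ) : weight L n ≤ 1 * (growth L n / (n + 1) ^ 3) := by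
  have hg := growth_nonneg L n
  rw [one_mul]
  unfold weight
  refine div_le_div_of_nonneg_left hg (by positivity) ?_
  exact pow_le_pow_right₀ (by linarith [(n.cast_nonneg : (0 : ℝ) ≤ n)]) (by norm_num)

lemma weight₁_le_cube (hL : 1 ≤ L) (n : ℕ) :
    weight₁ L n ≤ L * (growth L n / (n + 1) ^ 3) := by
  have h1 := growth_add_le hL 1 n
  have hg := growth_nonneg L n
  rw [pow_one] at h1
  unfold weight₁ weight
  push_cast
  calc ((n : ℝ) + 1) * (growth L (n + 1) / (n + 1 + 1) ^ 4)
      ≤ ((n : ℝ) + 1) * (L * growth L n / (n + 1) ^ 4) := by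
        gcongr ?_ * (?_ / ?_ ^ 4)
        linarith
    _ = _ := by field_simp

lemma weight₁_le_sq (hL : 1 ≤ L) (n : ℕ) :
    weight₁ L n ≤ L * (growth L n / (n + 1) ^ 2) := by
  refine (weight₁_le_cube hL n).trans ?_
  have hg := growth_nonneg L n
  refine mul_le_mul_of_nonneg_left (div_le_div_of_nonneg_left hg (by positivity) ?_)
    L.cast_nonneg
  exact pow_le_pow_right₀ (by linarith [(n.cast_nonneg : (0 : ℝ) ≤ n)]) (by norm_num)

lemma weight₂_le_sq (hL : 1 ≤ L) (n : ℕ) :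
    weight₂ L n ≤ L ^ 2 * (growth L n / (n + 1) ^ 2) := by
  have h1 := growth_add_le hL 2 n
  have hg := growth_nonneg L n
  unfold weight₂ weight
  push_cast
  calc ((n : ℝ) + 1) * (n + 2) * (growth L (n + 2) / (n + 2 + 1) ^ 4)
      ≤ ((n : ℝ) + 2 + 1) * (n + 2 + 1) * (L ^ 2 * growth L n / (n + 2 + 1) ^ 4) := by
        have := growth_nonneg L (n + 2)
        gcongr ?_ * ?_ * (?_ / _) <;> linarith
    _ = L ^ 2 * (growth L n / (n + 2 + 1) ^ 2) := by field_simp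
    _ ≤ _ := by gcongr; linarith

/-- The constant is `2 ^ 4`, from `n + 2 ≤ 2 (n + 1)`; the `81 = 3 ^ 4` of `sq_le_weight₂` comes
from `n + 3 ≤ 3 (n + 1)`. -/
lemma cube_le_weight₁ (hL : 1 ≤ L) (n : ℕ) : growth L n / (n + 1) ^ 3 ≤ 16 * weight₁ L n := by
  have h1 := growth_mono hL (Nat.le_succ n)
  have hg := growth_nonneg L n
  unfold weight₁ weight
  push_cast
  calc growth L n / ((n : ℝ) + 1) ^ 3
      = 16 * ((n + 1) * (growth L n / (2 * (n + 1)) ^ 4)) := by field_simp; norm_num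
    _ ≤ 16 * ((n + 1) * (growth L (n + 1) / (n + 1 + 1) ^ 4)) := by
        have := growth_nonneg L (n + 1)
        have hn : (0 : ℝ) ≤ n := n.cast_nonneg
        gcongr ?_ * (?_ * (?_ / ?_ ^ 4))
        linarith

lemma sq_le_weight₂ (hL : 1 ≤ L) (n : ℕ) : growth L n / (n + 1) ^ 2 ≤ 81 * weight₂ L n := by
  have h1 := growth_mono hL (Nat.le_add_right n 2)
  have hg := growth_nonneg L n
  have hn : (0 : ℝ) ≤ n := n.cast_nonneg
  unfold weight₂ weight
  push_cast
  calc growth L n / ((n : ℝ) + 1) ^ 2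
      = 81 * ((n + 1) * (n + 1) * (growth L n / (3 * (n + 1)) ^ 4)) := by field_simp; norm_num
    _ ≤ 81 * ((n + 1) * (n + 2) * (growth L (n + 2) / (n + 2 + 1) ^ 4)) := by
        have := growth_nonneg L (n + 2)
        gcongr ?_ * (?_ * ?_ * (?_ / ?_ ^ 4))
        · linarith
        · linarith

/-- The fourth power in the weights leaves an inverse square after two derivatives, which is still
closed under Cauchy products. The constant is rounded up so that one smallness condition on `M`
serves this product and the one in `conv_weight_weight₁_le`. -/
lemma conv_weight₁_weight₂_le (hL : 1 ≤ L) (n : ℕ) :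
    conv (weight₁ L) (weight₂ L) n ≤ 2000 * L ^ (L + 3) * weight₂ L n := by
  have h := conv_growth_le hL le_rfl (A := L) (B := L ^ 2) (by positivity) (by positivity)
    (weight₂_nonneg L) (weight₁_le_sq hL) (weight₂_le_sq hL) n
  have hw := weight₂_nonneg L n
  calc _ ≤ _ := h
    _ ≤ 2 ^ (2 + 2) * ((L : ℝ) * L ^ 2) * L ^ L * (81 * weight₂ L n) := by
        gcongr; exact sq_le_weight₂ hL n
    _ = 1296 * L ^ (L + 3) * weight₂ L n := by rw [pow_add]; ring
    _ ≤ _ := by gcongr; norm_num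

lemma conv_weight_weight₁_le (hL : 1 ≤ L) (n : ℕ) :
    conv (weight L) (weight₁ L) n ≤ 2000 * L ^ (L + 3) * weight₁ L n := by
  have h := conv_growth_le hL (p := 3) (by norm_num) (A := 1) (B := L) (by positivity)
    (by positivity) (weight₁_nonneg L) weight_le_cube (weight₁_le_cube hL) n
  have hw := weight₁_nonneg L n
  have hL' : (1 : ℝ) ≤ L := by exact_mod_cast hL
  calc _ ≤ _ := h
    _ ≤ 2 ^ (3 + 2) * ((1 : ℝ) * L) * L ^ L * (16 * weight₁ L n) := by
        gcongr; exact cube_le_weight₁ hL n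
    _ = 512 * L ^ (L + 1) * weight₁ L n := by rw [pow_add]; ring
    _ ≤ _ := by
        gcongr
        · norm_num
        · norm_num

/-- The purpose of the growing factor: a lower-order term with a large constant `D` is absorbed by a
second derivative. While `n + 2 ≤ L` the growth supplies a factor `L ^ 2`; afterwards the factor `n
+ 2` alone exceeds `L`. -/
lemma mul_weight_le {D : ℝ} (hD : 81 * D ≤ L) (hL : 1 ≤ L) (n : ℕ) :
    D * weight L n ≤ (n + 2) * weight L (n + 2) := by
  have hg := growth_nonneg L n
  have hn : (0 : ℝ) ≤ n := n.cast_nonneg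
  have hL' : (1 : ℝ) ≤ L := by exact_mod_cast hL
  have key : L * growth L n ≤ (n + 2) * growth L (n + 2) := by
    rcases le_or_gt (n + 2) L with h | h
    · have h1 : growth L (n + 2) = L ^ 2 * growth L n := by
        unfold growth
        rw [← pow_add]
        congr 1
        omega
      rw [h1]
      have : (L : ℝ) ≤ (n + 2) * L ^ 2 := by nlinarith
      calc _ ≤ ((n + 2) * (L : ℝ) ^ 2) * growth L n := by gcongr
        _ = _ := by ring
    · have h1 : (L : ℝ) ≤ n + 2 := by exact_mod_cast h.le
      have h2 := growth_mono hL (Nat.le_add_right n 2)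
      gcongr
  unfold weight
  push_cast
  calc D * (growth L n / ((n : ℝ) + 1) ^ 4)
      = (81 * D) * growth L n / (3 * (n + 1)) ^ 4 := by field_simp; norm_num
    _ ≤ L * growth L n / (3 * (n + 1)) ^ 4 := by gcongr
    _ ≤ (n + 2) * growth L (n + 2) / (n + 2 + 1) ^ 4 := by
        have := growth_nonneg L (n + 2)
        gcongr ?_ / ?_ ^ 4
        linarith
    _ = _ := by ring

end Weight

/-! ### The formal solution is majorized by the weights -/

lemma conv_const_mul (c d : ℝ) (α χ : ℕ → ℝ) (n : ℕ) :
    conv (fun n => c * α n) (fun n => d * χ n) n = c * d * conv α χ n := by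
  simp only [conv, Finset.mul_sum]
  exact Finset.sum_congr rfl fun l _ => by ring

lemma yint_neg (f : TimeSeries) : yint (-f) = -yint f := by
  refine PowerSeries.ext fun j => ?_
  cases j with
  | zero => simp only [map_neg, coeff_zero_yint, neg_zero]
  | succ j => ext τ; simp only [map_neg, coeff_succ_yint, Pi.neg_apply, neg_div]

section Invariance

variable {m ρ b τ M : ℝ} {L : ℕ} {u v : TimeSeries}

/-- The budget is as follows. With `a = 8b²`, `u_τ` costs `M/(8b²)`, and by the choice of `L` all
undifferentiated and `y u_y` terms together cost the same, giving `M/(4b²)` for the linear part `S`.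
Each multiplication by `u_y` gains `1/16` since `M` is small, so `u_y² S` at most doubles this. Two
integrations in `y` multiply by `b²` and return `M/2`, within the majorant of `u`. -/
lemma maj_graphRHS (hm : 0 ≤ m) (hb : 1 ≤ b) (hL1 : 1 ≤ L)
    (hL : 81 * (8 * (m + 1) * b ^ 2) ≤ L) (hM : 0 ≤ M) (hML : 16 * M * (2000 * L ^ (L + 3)) ≤ 1)
    (hsu : SmoothCoeffs u) (hsv : SmoothCoeffs v)
    (hu : Maj (8 * b ^ 2) b τ u fun n => M * weight L n)
    (hv : Maj (8 * b ^ 2) b τ v fun n => M * weight L n) :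
    Maj (8 * b ^ 2) b τ (graphRHS m u v) fun n => M / (2 * b ^ 2) * weight₂ L n := by
  have hb0 : 0 < b := by linarith
  have ha : 0 < 8 * b ^ 2 := by positivity
  have hw := weight_nonneg L
  have hw1 := weight₁_nonneg L
  have hw2 := weight₂_nonneg L
  have hMw : ∀ n, 0 ≤ M * weight L n := fun n => mul_nonneg hM (hw n)
  set S : TimeSeries :=
    dt u + const m * v - const (1 / 2) * u + const (1 / 2) * (X * dy u) with hS
  have hsX : SmoothCoeffs (X * dy u) := SmoothCoeffs.X.mul hsu.dy
  have hsmv : SmoothCoeffs (const m * v) := (SmoothCoeffs.const m).mul hsv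
  have hshu : SmoothCoeffs (const (1 / 2) * u) := (SmoothCoeffs.const _).mul hsu
  have hshX : SmoothCoeffs (const (1 / 2) * (X * dy u)) := (SmoothCoeffs.const _).mul hsX
  have hsS : SmoothCoeffs S := ((hsu.dt.add hsmv).sub hshu).add hshX
  have hmajS : Maj (8 * b ^ 2) b τ S fun n => M / (4 * b ^ 2) * weight₂ L n := by
    have h1 := Maj.add ha.le hb0.le ((hsu.dt.add hsmv).sub hshu) hshX
      (Maj.sub ha.le hb0.le (hsu.dt.add hsmv) hshu
        (Maj.add ha.le hb0.le hsu.dt hsmv (hu.dt ha) (hv.const_mul hsv m))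
        (hu.const_mul hsu (1 / 2)))
      ((hu.X_mul_dy hMw hsu).const_mul hsX (1 / 2))
    refine h1.mono fun n => ?_
    have h2 := mul_weight_le hL hL1 n
    have h3 := hw n
    have hn : (0 : ℝ) ≤ n := n.cast_nonneg
    have h4 : |(1 / 2 : ℝ)| = 1 / 2 := abs_of_nonneg (by norm_num)
    rw [abs_of_nonneg hm, h4]
    have h5 : (m + 1) * (n + 1) * weight L n ≤ 1 / (8 * b ^ 2) * weight₂ L n := by
      unfold weight₂
      calc _ = 1 / (8 * b ^ 2) * ((n + 1) * (8 * (m + 1) * b ^ 2 * weight L n)) := by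
            field_simp
        _ ≤ 1 / (8 * b ^ 2) * ((n + 1) * ((n + 2) * weight L (n + 2))) := by gcongr
        _ = _ := by ring
    have h6 : m + 1 / 2 + n / 2 ≤ (m + 1) * (n + 1) := by nlinarith
    calc _ = M * (1 / (8 * b ^ 2) * weight₂ L n + (m + 1 / 2 + n / 2) * weight L n) := by
          unfold weight₂; field_simp; ring
      _ ≤ M * (1 / (8 * b ^ 2) * weight₂ L n + (m + 1) * (n + 1) * weight L n) := by gcongr
      _ ≤ M * (1 / (8 * b ^ 2) * weight₂ L n + 1 / (8 * b ^ 2) * weight₂ L n) := by gcongr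
      _ = _ := by ring
  have hdy : Maj (8 * b ^ 2) b τ (dy u) fun n => (b⁻¹ * M) * weight₁ L n :=
    (hu.dy hb0 hsu).mono fun n => le_of_eq (by unfold weight₁; ring)
  have hbi : b⁻¹ ≤ 1 := inv_le_one_of_one_le₀ hb
  have hmulS : ∀ {f : TimeSeries} {c : ℝ}, 0 ≤ c → SmoothCoeffs f →
      (Maj (8 * b ^ 2) b τ f fun n => c * weight₂ L n) →
      Maj (8 * b ^ 2) b τ (dy u * f) fun n => (c / 16) * weight₂ L n := by
    intro f c hc hsf hf
    refine (Maj.mul ha.le hb0.le hsu.dy hsf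
      (fun n => mul_nonneg (by positivity) (hw1 n))
      (fun n => mul_nonneg hc (hw2 n)) hdy hf).mono fun n => ?_
    rw [conv_const_mul]
    have h1 := conv_weight₁_weight₂_le hL1 n
    have h2 := hw2 n
    calc _ ≤ b⁻¹ * M * c * (2000 * L ^ (L + 3) * weight₂ L n) := by gcongr
      _ ≤ 1 * M * c * (2000 * L ^ (L + 3) * weight₂ L n) := by gcongr
      _ = (16 * M * (2000 * L ^ (L + 3))) * (c / 16 * weight₂ L n) := by ring
      _ ≤ 1 * (c / 16 * weight₂ L n) := by gcongr
      _ = _ := one_mul _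
  have hc : 0 ≤ M / (4 * b ^ 2) := by positivity
  have h2 := hmulS (by positivity) (hsu.dy.mul hsS) (hmulS hc hsS hmajS)
  have h3 := Maj.add ha.le hb0.le hsS (hsu.dy.mul (hsu.dy.mul hsS)) hmajS h2
  have h4 : graphRHS m u v = S + dy u * (dy u * S) := by
    rw [graphRHS, ← hS]; ring
  rw [h4]
  refine h3.mono fun n => ?_
  have h5 := hw2 n
  rw [← add_mul]
  refine mul_le_mul_of_nonneg_right ?_ h5
  have : M / (2 * b ^ 2) = 2 * (M / (4 * b ^ 2)) := by field_simp; norm_num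
  rw [this]
  linarith

/-- Multiplication by `ρ⁻¹ + v` does not enlarge the majorant: `ρ⁻¹ ≤ 3/4`, and the convolution with
`v` contributes at most `1/16`. -/
lemma maj_reciprocalRHS (hρ : 4 / 3 ≤ ρ) (hb : 1 ≤ b) (hL1 : 1 ≤ L)
    (hM : 0 ≤ M) (hML : 16 * M * (2000 * L ^ (L + 3)) ≤ 1)
    (hsu : SmoothCoeffs u) (hsv : SmoothCoeffs v)
    (hu : Maj (8 * b ^ 2) b τ u fun n => M * weight L n)
    (hv : Maj (8 * b ^ 2) b τ v fun n => M * weight L n) :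
    Maj (8 * b ^ 2) b τ ((const ρ⁻¹ + v) * (const ρ⁻¹ + v) * dy u)
      fun n => (b⁻¹ * M) * weight₁ L n := by
  have hb0 : 0 < b := by linarith
  have ha : 0 < 8 * b ^ 2 := by positivity
  have hw := weight_nonneg L
  have hw1 := weight₁_nonneg L
  have hρ0 : 0 < ρ := by linarith
  have hρi : ρ⁻¹ ≤ 3 / 4 := by
    rw [show (3 / 4 : ℝ) = (4 / 3)⁻¹ by norm_num]
    exact inv_anti₀ (by norm_num) hρ
  have hdy : Maj (8 * b ^ 2) b τ (dy u) fun n => (b⁻¹ * M) * weight₁ L n :=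
    (hu.dy hb0 hsu).mono fun n => le_of_eq (by unfold weight₁; ring)
  have key : ∀ {f : TimeSeries}, SmoothCoeffs f →
      (Maj (8 * b ^ 2) b τ f fun n => (b⁻¹ * M) * weight₁ L n) →
      Maj (8 * b ^ 2) b τ ((const ρ⁻¹ + v) * f) fun n => (b⁻¹ * M) * weight₁ L n := by
    intro f hsf hf
    have h1 : (const ρ⁻¹ + v) * f = const ρ⁻¹ * f + v * f := by ring
    rw [h1]
    refine (Maj.add ha.le hb0.le ((SmoothCoeffs.const _).mul hsf) (hsv.mul hsf)
      (hf.const_mul hsf ρ⁻¹)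
      (Maj.mul ha.le hb0.le hsv hsf (fun n => mul_nonneg hM (hw n))
        (fun n => mul_nonneg (by positivity) (hw1 n)) hv hf)).mono fun n => ?_
    rw [conv_const_mul, abs_of_nonneg (by positivity)]
    have h2 := conv_weight_weight₁_le hL1 n
    have h3 := hw1 n
    have h4 : 0 ≤ b⁻¹ * M * weight₁ L n := by positivity
    calc _ ≤ ρ⁻¹ * (b⁻¹ * M * weight₁ L n)
          + M * (b⁻¹ * M) * (2000 * L ^ (L + 3) * weight₁ L n) := by gcongr
      _ = (ρ⁻¹ + (16 * M * (2000 * L ^ (L + 3))) / 16) * (b⁻¹ * M * weight₁ L n) := by ring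
      _ ≤ 1 * (b⁻¹ * M * weight₁ L n) := by
          refine mul_le_mul_of_nonneg_right ?_ h4
          linarith
      _ = _ := one_mul _
  rw [mul_assoc]
  exact key (((SmoothCoeffs.const _).add hsv).mul hsu.dy) (key hsu.dy hdy)

variable {g h : ℝ → ℝ}

lemma maj_picardIter (hm : 0 ≤ m) (hρ : 4 / 3 ≤ ρ) (hb : 1 ≤ b) (hL1 : 1 ≤ L)
    (hL : 81 * (8 * (m + 1) * b ^ 2) ≤ L) (hM : 0 ≤ M) (hML : 16 * M * (2000 * L ^ (L + 3)) ≤ 1)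
    (hg : ContDiff ℝ ∞ g) (hh : ContDiff ℝ ∞ h)
    (hg0 : ∀ i, |iteratedDeriv i g τ| * (8 * b ^ 2) ^ i ≤ (2 * i)! * (M * weight L (2 * i)))
    (hh0 : ∀ i, |iteratedDeriv i h τ| * (8 * b ^ 2) ^ i ≤ (2 * i)! * (M * weight L (2 * i)))
    (k : ℕ) :
    (Maj (8 * b ^ 2) b τ (picardIter m ρ g h k).1 fun n => M * weight L n) ∧
      Maj (8 * b ^ 2) b τ (picardIter m ρ g h k).2 fun n => M * weight L n := by
  have hb0 : 0 < b := by linarith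
  have hw := weight_nonneg L
  have hw1 := weight₁_nonneg L
  have hw2 := weight₂_nonneg L
  have hzero : ∀ i, iteratedDeriv i (0 : ℝ → ℝ) τ = 0 := by
    intro i
    change iteratedDeriv i (fun _ => (0 : ℝ)) τ = 0
    rw [iteratedDeriv_const]; split_ifs <;> rfl
  have hMaj0 : Maj (8 * b ^ 2) b τ 0 fun _ => (0 : ℝ) := by
    intro i j
    rw [map_zero, hzero]
    simp
  induction k with
  | zero =>
    refine ⟨?_, hMaj0.mono fun n => mul_nonneg hM (hw n)⟩
    have h1 := hMaj0.C_add_yint hb0.le (χ := fun n => M * weight L n) hg0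
      (fun n => by rw [mul_zero]; exact mul_nonneg (by positivity) (mul_nonneg hM (hw _)))
    have h2 : yint 0 = 0 := by
      refine PowerSeries.ext fun j => ?_
      cases j with
      | zero => rw [coeff_zero_yint, map_zero]
      | succ j => rw [coeff_succ_yint, map_zero]; ext τ; simp
    rw [h2, add_zero] at h1
    exact h1
  | succ k ih =>
    rw [picardIter_succ]
    obtain ⟨hu, hv⟩ := ih
    obtain ⟨hsu, hsv⟩ := smoothCoeffs_picardIter (m := m) (ρ := ρ) hg hh k
    constructor
    · have h1 := maj_graphRHS hm hb hL1 hL hM hML hsu hsv hu hv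
      have h2 := h1.C_add_yint hb0.le (g := 0) (χ := fun n => M / (2 * b) * weight₁ L n)
        (fun i => by
          rw [hzero, abs_zero, zero_mul]
          exact mul_nonneg (by positivity) (mul_nonneg (by positivity) (hw1 _)))
        (fun n => le_of_eq (by unfold weight₁ weight₂; push_cast; field_simp; ring_nf))
      rw [map_zero, zero_add] at h2
      refine h2.C_add_yint hb0.le hg0 fun n => ?_
      have h3 : 0 ≤ M * ((n + 1) * weight L (n + 1)) :=
        mul_nonneg hM (mul_nonneg (by positivity) (hw _))
      unfold weight₁
      calc _ = 1 / 2 * (M * ((n + 1) * weight L (n + 1))) := by field_simp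
        _ ≤ M * ((n + 1) * weight L (n + 1)) := by linarith
        _ = _ := by ring
    · have h1 := (maj_reciprocalRHS hρ hb hL1 hM hML hsu hsv hu hv).neg
      have h2 := h1.C_add_yint hb0.le (χ := fun n => M * weight L n) hh0
        (fun n => le_of_eq (by unfold weight₁; field_simp))
      rw [yint_neg, ← sub_eq_add_neg] at h2
      exact h2

theorem maj_formalSol (hm : 0 ≤ m) (hρ : 4 / 3 ≤ ρ) (hb : 1 ≤ b) (hL1 : 1 ≤ L)
    (hL : 81 * (8 * (m + 1) * b ^ 2) ≤ L) (hM : 0 ≤ M) (hML : 16 * M * (2000 * L ^ (L + 3)) ≤ 1)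
    (hg : ContDiff ℝ ∞ g) (hh : ContDiff ℝ ∞ h)
    (hg0 : ∀ i, |iteratedDeriv i g τ| * (8 * b ^ 2) ^ i ≤ (2 * i)! * (M * weight L (2 * i)))
    (hh0 : ∀ i, |iteratedDeriv i h τ| * (8 * b ^ 2) ^ i ≤ (2 * i)! * (M * weight L (2 * i))) :
    (Maj (8 * b ^ 2) b τ (formalSol m ρ g h).1 fun n => M * weight L n) ∧
      Maj (8 * b ^ 2) b τ (formalSol m ρ g h).2 fun n => M * weight L n := by
  have key := maj_picardIter hm hρ hb hL1 hL hM hML hg hh hg0 hh0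
  refine ⟨fun i j => ?_, fun i j => ?_⟩
  · rw [coeff_formalSol_fst]
    exact (key j).1 i j
  · rw [coeff_formalSol_snd]
    exact (key (j + 1)).2 i j

end Invariance

/-! ### Summation of the series -/

/-- The sum of the series at `(y, τ)`. -/
noncomputable def eval (f : TimeSeries) (z : ℝ × ℝ) : ℝ := ∑' j, coeff j f z.2 * z.1 ^ j

/-- Absolute convergence at `(y, τ)`. -/
def AbsConv (f : TimeSeries) (z : ℝ × ℝ) : Prop := Summable fun j => ‖coeff j f z.2 * z.1 ^ j‖

namespace AbsConv

variable {f g : TimeSeries} {z : ℝ × ℝ}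

lemma summable (hf : AbsConv f z) : Summable fun j => coeff j f z.2 * z.1 ^ j :=
  Summable.of_norm hf

lemma hasSum (hf : AbsConv f z) : HasSum (fun j => coeff j f z.2 * z.1 ^ j) (eval f z) :=
  hf.summable.hasSum

lemma add (hf : AbsConv f z) (hg : AbsConv g z) : AbsConv (f + g) z := by
  refine Summable.of_nonneg_of_le (fun _ => norm_nonneg _) (fun j => ?_) (Summable.add hf hg)
  rw [map_add, Pi.add_apply, add_mul]
  exact norm_add_le _ _

lemma neg (hf : AbsConv f z) : AbsConv (-f) z := by
  unfold AbsConv at *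
  simpa using hf

lemma sub (hf : AbsConv f z) (hg : AbsConv g z) : AbsConv (f - g) z := by
  rw [sub_eq_add_neg]
  exact hf.add hg.neg

lemma coeff_mul_apply (f g : TimeSeries) (z : ℝ × ℝ) (j : ℕ) :
    coeff j (f * g) z.2 * z.1 ^ j = ∑ p ∈ Finset.HasAntidiagonal.antidiagonal j,
      (coeff p.1 f z.2 * z.1 ^ p.1) * (coeff p.2 g z.2 * z.1 ^ p.2) := by
  rw [PowerSeries.coeff_mul, Finset.sum_apply, Finset.sum_mul]
  refine Finset.sum_congr rfl fun p hp => ?_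
  have := Finset.HasAntidiagonal.mem_antidiagonal.1 hp
  rw [Pi.mul_apply, ← this, pow_add]
  ring

lemma mul (hf : AbsConv f z) (hg : AbsConv g z) : AbsConv (f * g) z := by
  have h := summable_norm_sum_mul_antidiagonal_of_summable_norm hf hg
  exact h.congr fun j => by rw [coeff_mul_apply]

lemma C (g : ℝ → ℝ) (z : ℝ × ℝ) : AbsConv (C g) z := by
  refine summable_of_ne_finset_zero (s := {0}) fun j hj => ?_
  rw [PowerSeries.coeff_C, if_neg (by simpa using hj)]
  simp

lemma const (c : ℝ) (z : ℝ × ℝ) : AbsConv (const c) z := AbsConv.C _ z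

lemma one (z : ℝ × ℝ) : AbsConv 1 z := by
  rw [← map_one (PowerSeries.C (R := ℝ → ℝ))]
  exact AbsConv.C 1 z

lemma X (z : ℝ × ℝ) : AbsConv X z := by
  refine summable_of_ne_finset_zero (s := {1}) fun j hj => ?_
  rw [PowerSeries.coeff_X, if_neg (by simpa using hj)]
  simp

end AbsConv

section EvalAlgebra

variable {f g : TimeSeries} {z : ℝ × ℝ}

lemma eval_add (hf : AbsConv f z) (hg : AbsConv g z) : eval (f + g) z = eval f z + eval g z := by
  unfold eval
  rw [← hf.summable.tsum_add hg.summable]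
  exact tsum_congr fun j => by rw [map_add, Pi.add_apply, add_mul]

lemma eval_neg : eval (-f) z = -eval f z := by
  unfold eval
  rw [← tsum_neg]
  exact tsum_congr fun j => by rw [map_neg, Pi.neg_apply, neg_mul]

lemma eval_sub (hf : AbsConv f z) (hg : AbsConv g z) : eval (f - g) z = eval f z - eval g z := by
  rw [sub_eq_add_neg, eval_add hf hg.neg, eval_neg, sub_eq_add_neg]

lemma eval_mul (hf : AbsConv f z) (hg : AbsConv g z) : eval (f * g) z = eval f z * eval g z := by
  unfold eval
  rw [tsum_mul_tsum_eq_tsum_sum_antidiagonal_of_summable_norm hf hg]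
  exact tsum_congr fun j => AbsConv.coeff_mul_apply f g z j

lemma eval_C (g : ℝ → ℝ) (z : ℝ × ℝ) : eval (C g) z = g z.2 := by
  unfold eval
  rw [tsum_eq_single 0]
  · simp
  · intro j hj
    rw [PowerSeries.coeff_C, if_neg hj]
    simp

lemma eval_const (c : ℝ) (z : ℝ × ℝ) : eval (const c) z = c := eval_C _ z

lemma eval_one (z : ℝ × ℝ) : eval 1 z = 1 := by
  rw [← map_one (PowerSeries.C (R := ℝ → ℝ)), eval_C]
  rfl

lemma eval_X (z : ℝ × ℝ) : eval X z = z.1 := by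
  unfold eval
  rw [tsum_eq_single 1]
  · rw [PowerSeries.coeff_X, if_pos rfl]; simp
  · intro j hj
    rw [PowerSeries.coeff_X, if_neg hj]
    simp

lemma eval_fst_zero (f : TimeSeries) (τ : ℝ) : eval f (0, τ) = coeff 0 f τ := by
  unfold eval
  rw [tsum_eq_single 0]
  · simp
  · intro j hj
    simp [hj]

end EvalAlgebra

lemma exists_pow_mul_geometric_le (k : ℕ) {r : ℝ} (hr0 : 0 ≤ r) (hr : r < 1) :
    ∃ K, ∀ j : ℕ, ((j : ℝ) + 1) ^ k * r ^ j ≤ K := by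
  have h1 : Summable fun n : ℕ => (n : ℝ) ^ k * r ^ n :=
    summable_pow_mul_geometric_of_norm_lt_one k (by rwa [Real.norm_of_nonneg hr0])
  obtain ⟨K, hK⟩ := h1.tendsto_atTop_zero.bddAbove_range
  refine ⟨2 ^ k * (K + 1), fun j => ?_⟩
  rcases Nat.eq_zero_or_pos j with rfl | hj
  · have h3 : (0 : ℝ) ≤ K := (by positivity : (0 : ℝ) ≤ ((0 : ℕ) : ℝ) ^ k * r ^ 0).trans
      (hK ⟨0, rfl⟩)
    have h4 : (1 : ℝ) ≤ 2 ^ k := one_le_pow₀ (by norm_num)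
    simp only [Nat.cast_zero, zero_add, one_pow, pow_zero, mul_one]
    nlinarith
  · have h3 : (j : ℝ) + 1 ≤ 2 * j := by
      have : (1 : ℝ) ≤ j := by exact_mod_cast hj
      linarith
    have h4 : (j : ℝ) ^ k * r ^ j ≤ K := hK ⟨j, rfl⟩
    calc ((j : ℝ) + 1) ^ k * r ^ j ≤ (2 * j) ^ k * r ^ j := by gcongr
      _ = 2 ^ k * (j ^ k * r ^ j) := by rw [mul_pow]; ring
      _ ≤ 2 ^ k * (K + 1) := by gcongr; linarith

/-! ### Termwise differentiation and smoothness of the sum -/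

/-- All `τ`-derivatives of the coefficients are controlled uniformly for `τ ∈ I`, with radius of
convergence at least `b` in `y`. -/
structure Regular (b : ℝ) (I : Set ℝ) (f : TimeSeries) : Prop where
  smooth : SmoothCoeffs f
  bound : ∀ i : ℕ, ∀ β : ℝ, 0 < β → β < b → ∃ K, ∀ j : ℕ, ∀ τ ∈ I,
    |iteratedDeriv i (coeff j f) τ| * β ^ j ≤ K

namespace Regular

variable {b : ℝ} {I : Set ℝ} {f : TimeSeries}

lemma dt (hf : Regular b I f) : Regular b I (dt f) := by
  refine ⟨hf.smooth.dt, fun i β h0 hβ => ?_⟩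
  obtain ⟨K, hK⟩ := hf.bound (i + 1) β h0 hβ
  refine ⟨K, fun j τ hτ => ?_⟩
  rw [coeff_dt, ← iteratedDeriv_succ']
  exact hK j τ hτ

lemma dy (hf : Regular b I f) : Regular b I (dy f) := by
  refine ⟨hf.smooth.dy, fun i β h0 hβ => ?_⟩
  obtain ⟨β', hβ', hb'⟩ := exists_between hβ
  have h0' : 0 < β' := h0.trans hβ'
  obtain ⟨K, hK⟩ := hf.bound i β' h0' hb'
  obtain ⟨K', hK'⟩ := exists_pow_mul_geometric_le 1 (r := β / β') (by positivity)
    ((div_lt_one h0').2 hβ')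
  refine ⟨K * (β'⁻¹ * K'), fun j τ hτ => ?_⟩
  rw [coeff_dy', iteratedDeriv_const_mul _ (Maj.contDiffAt hf.smooth i _), abs_mul,
    abs_of_nonneg (by positivity : (0 : ℝ) ≤ (j : ℝ) + 1)]
  have h1 := hK (j + 1) τ hτ
  have h2 := hK' j
  have h3 : 0 ≤ K := le_trans (by positivity) h1
  calc _ = (|iteratedDeriv i (coeff (j + 1) f) τ| * β' ^ (j + 1)) *
        (β'⁻¹ * (((j : ℝ) + 1) ^ 1 * (β / β') ^ j)) := by
        rw [div_pow, pow_succ β']; field_simp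
    _ ≤ _ := by gcongr

lemma norm_le (hf : Regular b I f) {β β' : ℝ} (h0 : 0 < β') (hβ' : β' < b) (hβ0 : 0 ≤ β) :
    ∃ K, 0 ≤ K ∧ ∀ j : ℕ, ∀ z : ℝ × ℝ, |z.1| ≤ β → z.2 ∈ I →
      ‖coeff j f z.2 * z.1 ^ j‖ ≤ K * (β / β') ^ j := by
  obtain ⟨K, hK⟩ := hf.bound 0 β' h0 hβ'
  refine ⟨max K 0, le_max_right _ _, fun j z hz hzI => ?_⟩
  have h1 := hK j z.2 hzI
  rw [iteratedDeriv_zero] at h1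
  rw [Real.norm_eq_abs, abs_mul, abs_pow]
  calc _ ≤ |coeff j f z.2| * β ^ j := by gcongr
    _ = (|coeff j f z.2| * β' ^ j) * (β / β') ^ j := by rw [div_pow]; field_simp
    _ ≤ _ := by gcongr; exact h1.trans (le_max_left _ _)

lemma absConv (hf : Regular b I f) {z : ℝ × ℝ} (hz : |z.1| < b) (hzI : z.2 ∈ I) :
    AbsConv f z := by
  have h0 : 0 < (|z.1| + b) / 2 := by have := abs_nonneg z.1; linarith
  have hlt : |z.1| < (|z.1| + b) / 2 := by linarith
  obtain ⟨K, _, hK⟩ := hf.norm_le (β := |z.1|) h0 (by linarith) (abs_nonneg _)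
  refine Summable.of_nonneg_of_le (fun _ => norm_nonneg _) (fun j => hK j z le_rfl hzI) ?_
  exact (summable_geometric_of_lt_one (by positivity) ((div_lt_one h0).2 hlt)).mul_left K

/-- The differential of the sum. -/
noncomputable def evalDeriv (f : TimeSeries) (z : ℝ × ℝ) : ℝ × ℝ →L[ℝ] ℝ :=
  eval (TimeSeries.dy f) z • ContinuousLinearMap.fst ℝ ℝ ℝ +
    eval (TimeSeries.dt f) z • ContinuousLinearMap.snd ℝ ℝ ℝ

lemma hasFDerivAt_eval (hI : IsOpen I) (hI' : IsPreconnected I) (hf : Regular b I f) {z : ℝ × ℝ}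
    (hz : |z.1| < b) (hzI : z.2 ∈ I) : HasFDerivAt (eval f) (evalDeriv f z) z := by
  obtain ⟨β, hzβ, hβb⟩ := exists_between hz
  obtain ⟨β', hββ', hβ'b⟩ := exists_between hβb
  have hβ0 : 0 < β := (abs_nonneg _).trans_lt hzβ
  have hβ'0 : 0 < β' := hβ0.trans hββ'
  have hr0 : 0 ≤ β / β' := by positivity
  have hr1 : β / β' < 1 := (div_lt_one hβ'0).2 hββ'
  obtain ⟨K₁, hK₁, h₁⟩ := hf.dy.norm_le (β := β) hβ'0 hβ'b hβ0.le
  obtain ⟨K₂, hK₂, h₂⟩ := hf.dt.norm_le (β := β) hβ'0 hβ'b hβ0.le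
  set s : Set (ℝ × ℝ) := Metric.ball 0 β ×ˢ I with hs
  have hmem : ∀ x ∈ s, |x.1| ≤ β ∧ x.2 ∈ I := by
    intro x hx
    have h := (Set.mem_prod.1 hx).1
    rw [mem_ball_zero_iff, Real.norm_eq_abs] at h
    exact ⟨h.le, (Set.mem_prod.1 hx).2⟩
  set F' : ℕ → ℝ × ℝ → ℝ × ℝ →L[ℝ] ℝ := fun j x =>
    (coeff j f x.2 * (j * x.1 ^ (j - 1))) • ContinuousLinearMap.fst ℝ ℝ ℝ +
      (x.1 ^ j * deriv (coeff j f) x.2) • ContinuousLinearMap.snd ℝ ℝ ℝ with hF'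
  have hderiv : ∀ j, ∀ x ∈ s, HasFDerivAt (fun z : ℝ × ℝ => coeff j f z.2 * z.1 ^ j)
      (F' j x) x := by
    intro j x _
    have hc : HasDerivAt (coeff j f) (deriv (coeff j f) x.2) x.2 :=
      ((hf.smooth j).differentiable (by simp) x.2).hasDerivAt
    have hc' := hc.comp_hasFDerivAt x (hasFDerivAt_snd (𝕜 := ℝ) (p := x))
    have hp := (hasDerivAt_pow j x.1).comp_hasFDerivAt x (hasFDerivAt_fst (𝕜 := ℝ) (p := x))
    have := hc'.mul hp
    refine this.congr_fderiv ?_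
    ext <;> simp [hF']
  have hshift : ∀ j, ∀ x : ℝ × ℝ, coeff (j + 1) f x.2 * (((j + 1 : ℕ) : ℝ) * x.1 ^ (j + 1 - 1))
      = coeff j (TimeSeries.dy f) x.2 * x.1 ^ j := by
    intro j x
    rw [coeff_dy, Nat.add_sub_cancel]
    push_cast
    ring
  -- The `y`-derivative of the term of index `j + 1` is the term of index `j` of `dy f`, and the
  -- term of index `0` contributes nothing; the bound is shifted accordingly.
  set B : ℕ → ℝ := fun j => match j with
    | 0 => 0
    | j + 1 => K₁ * (β / β') ^ j with hB
  have hBsum : Summable B := by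
    rw [← summable_nat_add_iff 1]
    exact (summable_geometric_of_lt_one hr0 hr1).mul_left K₁
  have hbound : ∀ j, ∀ x ∈ s, ‖F' j x‖ ≤ B j + K₂ * (β / β') ^ j := by
    intro j x hx
    obtain ⟨hx1, hx2⟩ := hmem x hx
    have hA : ‖coeff j f x.2 * (j * x.1 ^ (j - 1))‖ ≤ B j := by
      cases j with
      | zero => simp [hB]
      | succ j => rw [hshift]; exact h₁ j x hx1 hx2
    have hD : ‖x.1 ^ j * deriv (coeff j f) x.2‖ ≤ K₂ * (β / β') ^ j := by
      have := h₂ j x hx1 hx2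
      rwa [coeff_dt, mul_comm] at this
    have hfst : ‖ContinuousLinearMap.fst ℝ ℝ ℝ‖ ≤ 1 := ContinuousLinearMap.norm_fst_le ..
    have hsnd : ‖ContinuousLinearMap.snd ℝ ℝ ℝ‖ ≤ 1 := ContinuousLinearMap.norm_snd_le ..
    calc ‖F' j x‖ ≤ ‖coeff j f x.2 * (j * x.1 ^ (j - 1))‖ * ‖ContinuousLinearMap.fst ℝ ℝ ℝ‖ +
          ‖x.1 ^ j * deriv (coeff j f) x.2‖ * ‖ContinuousLinearMap.snd ℝ ℝ ℝ‖ := by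
          refine (norm_add_le _ _).trans ?_
          rw [norm_smul, norm_smul]
      _ ≤ ‖coeff j f x.2 * (j * x.1 ^ (j - 1))‖ * 1 +
          ‖x.1 ^ j * deriv (coeff j f) x.2‖ * 1 := by gcongr
      _ ≤ _ := by rw [mul_one, mul_one]; exact add_le_add hA hD
  have hzs : z ∈ s := by
    refine ⟨?_, hzI⟩
    rwa [mem_ball_zero_iff, Real.norm_eq_abs]
  have hmain := hasFDerivAt_tsum_of_isPreconnected
    (hBsum.add ((summable_geometric_of_lt_one hr0 hr1).mul_left K₂))
    (Metric.isOpen_ball.prod hI) ((convex_ball (0 : ℝ) β).isPreconnected.prod hI')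
    hderiv hbound hzs (hf.absConv hz hzI).summable hzs
  refine hmain.congr_fderiv ?_
  have hsum1 : HasSum (fun j => coeff j f z.2 * (j * z.1 ^ (j - 1)))
      (eval (TimeSeries.dy f) z) := by
    rw [← hasSum_nat_add_iff' 1]
    simp only [hshift]
    simpa using (hf.dy.absConv hz hzI).hasSum
  have hsum2 : HasSum (fun j => z.1 ^ j * deriv (coeff j f) z.2) (eval (TimeSeries.dt f) z) := by
    have := (hf.dt.absConv hz hzI).hasSum
    simpa [mul_comm] using this
  exact ((hsum1.smul_const _).add (hsum2.smul_const _)).tsum_eq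

/-- `Regular` is stable under `dy` and `dt` with the same `b` and `I`, and the differential of the
sum is made of the sums of these two series. The induction on the order of differentiability
therefore runs over all regular series at once. -/
lemma contDiffOn_eval (hI : IsOpen I) (hI' : IsPreconnected I) (hf : Regular b I f) :
    ContDiffOn ℝ ∞ (eval f) (Metric.ball 0 b ×ˢ I) := by
  have hopen : IsOpen ((Metric.ball (0 : ℝ) b) ×ˢ I) := Metric.isOpen_ball.prod hI
  have key : ∀ n : ℕ, ∀ f : TimeSeries, Regular b I f →
      ContDiffOn ℝ n (eval f) (Metric.ball 0 b ×ˢ I) := by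
    intro n
    have hD : ∀ f : TimeSeries, Regular b I f → ∀ z ∈ (Metric.ball (0 : ℝ) b) ×ˢ I,
        HasFDerivAt (eval f) (evalDeriv f z) z := by
      intro f hf z hz
      refine hf.hasFDerivAt_eval hI hI' ?_ hz.2
      simpa using hz.1
    induction n with
    | zero =>
      intro f hf
      rw [Nat.cast_zero, contDiffOn_zero]
      exact fun z hz => (hD f hf z hz).continuousAt.continuousWithinAt
    | succ n ih =>
      intro f hf
      rw [Nat.cast_succ, contDiffOn_succ_iff_fderiv_of_isOpen hopen]
      refine ⟨fun z hz => (hD f hf z hz).differentiableAt.differentiableWithinAt,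
        fun h => absurd h (by simp), ?_⟩
      have : ContDiffOn ℝ n (evalDeriv f) (Metric.ball 0 b ×ˢ I) :=
        ((ih _ hf.dy).smul contDiffOn_const).add ((ih _ hf.dt).smul contDiffOn_const)
      exact this.congr fun z hz => (hD f hf z hz).fderiv
  exact contDiffOn_infty.2 fun n => key n f hf

end Regular

lemma weight_le {L : ℕ} (hL : 1 ≤ L) (n : ℕ) : weight L n ≤ (L : ℝ) ^ L * (1 / (n + 1) ^ 2) := by
  have h1 := growth_le hL n
  have hn : (1 : ℝ) ≤ n + 1 := by linarith [(n.cast_nonneg : (0 : ℝ) ≤ n)]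
  unfold weight
  rw [mul_one_div]
  calc growth L n / ((n : ℝ) + 1) ^ 4 ≤ (L : ℝ) ^ L / (n + 1) ^ 4 := by gcongr
    _ ≤ _ := div_le_div_of_nonneg_left (by positivity) (by positivity)
        (pow_le_pow_right₀ hn (by norm_num))

/-- For fixed `i` the quotient `(2i + j)! / j!` is polynomial in `j`, so it costs nothing in the
radius of convergence. -/
lemma regular_of_maj {a b M : ℝ} {L : ℕ} {I : Set ℝ} {f : TimeSeries} (ha : 0 < a) (hb : 0 < b)
    (hM : 0 ≤ M) (hL : 1 ≤ L) (hs : SmoothCoeffs f)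
    (hf : ∀ τ ∈ I, Maj a b τ f fun n => M * weight L n) : Regular b I f := by
  refine ⟨hs, fun i β h0 hβ => ?_⟩
  obtain ⟨K, hK⟩ := exists_pow_mul_geometric_le (2 * i) (r := β / b) (by positivity)
    ((div_lt_one hb).2 hβ)
  refine ⟨(2 * i + 1) ^ (2 * i) * (M * (L : ℝ) ^ L) * (a ^ i)⁻¹ * K, fun j τ hτ => ?_⟩
  have h1 := hf τ hτ i j
  have hw : weight L (2 * i + j) ≤ (L : ℝ) ^ L := by
    refine (weight_le hL _).trans ?_
    refine mul_le_of_le_one_right (by positivity) ?_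
    rw [div_le_one (by positivity)]
    exact one_le_pow₀ (by linarith [((2 * i + j).cast_nonneg : (0 : ℝ) ≤ ((2 * i + j : ℕ) : ℝ))])
  have h2 : ((2 * i + j)! : ℝ) ≤ j ! * ((2 * i + 1) ^ (2 * i) * ((j : ℝ) + 1) ^ (2 * i)) := by
    rw [add_comm (2 * i) j, ← Nat.factorial_mul_ascFactorial, ← mul_pow]
    push_cast
    gcongr
    calc (((j + 1).ascFactorial (2 * i) : ℕ) : ℝ) ≤ (((j + 2 * i) ^ (2 * i) : ℕ) : ℝ) := by
          exact_mod_cast Nat.ascFactorial_le_pow_add j (2 * i)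
      _ ≤ _ := by
          push_cast
          gcongr
          have : (0 : ℝ) ≤ (i : ℝ) * j := by positivity
          have : (0 : ℝ) ≤ i := by positivity
          nlinarith
  have h3 : |iteratedDeriv i (coeff j f) τ| * a ^ i * b ^ j ≤
      ((2 * i + 1) ^ (2 * i) * ((j : ℝ) + 1) ^ (2 * i)) * (M * (L : ℝ) ^ L) := by
    have hj : (0 : ℝ) < j ! := by positivity
    refine le_of_mul_le_mul_left ?_ hj
    calc _ = |iteratedDeriv i (coeff j f) τ| * j ! * a ^ i * b ^ j := by ring
      _ ≤ (2 * i + j)! * (M * weight L (2 * i + j)) := h1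
      _ ≤ (j ! * ((2 * i + 1) ^ (2 * i) * ((j : ℝ) + 1) ^ (2 * i))) * (M * (L : ℝ) ^ L) := by
          have := weight_nonneg L (2 * i + j)
          gcongr
      _ = _ := by ring
  calc _ = (|iteratedDeriv i (coeff j f) τ| * a ^ i * b ^ j) * ((a ^ i)⁻¹ * (β / b) ^ j) := by
        rw [div_pow]; field_simp
    _ ≤ (((2 * i + 1) ^ (2 * i) * ((j : ℝ) + 1) ^ (2 * i)) * (M * (L : ℝ) ^ L)) *
        ((a ^ i)⁻¹ * (β / b) ^ j) := by gcongr
    _ = (2 * i + 1) ^ (2 * i) * (M * (L : ℝ) ^ L) * (a ^ i)⁻¹ *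
        (((j : ℝ) + 1) ^ (2 * i) * (β / b) ^ j) := by ring
    _ ≤ _ := by gcongr; exact hK j

/-- The closed interval `|y| ≤ b` is admissible because the weights are themselves summable. -/
lemma abs_eval_le_of_maj {a b M : ℝ} {L : ℕ} {f : TimeSeries} {z : ℝ × ℝ}
    (hM : 0 ≤ M) (hL : 1 ≤ L) (hf : Maj a b z.2 f fun n => M * weight L n) (hz : |z.1| ≤ b) :
    |eval f z| ≤ 2 * (M * (L : ℝ) ^ L) := by
  have hterm : ∀ j, ‖coeff j f z.2 * z.1 ^ j‖ ≤ M * (L : ℝ) ^ L * (1 / ((j : ℝ) + 1) ^ 2) := by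
    intro j
    have h1 := hf 0 j
    have hj : (0 : ℝ) < j ! := by positivity
    simp only [mul_zero, zero_add, iteratedDeriv_zero, pow_zero, mul_one] at h1
    rw [Real.norm_eq_abs, abs_mul, abs_pow]
    calc |coeff j f z.2| * |z.1| ^ j ≤ |coeff j f z.2| * b ^ j := by gcongr
      _ ≤ M * weight L j := by
          refine le_of_mul_le_mul_left ?_ hj
          calc _ = |coeff j f z.2| * j ! * b ^ j := by ring
            _ ≤ _ := h1
      _ ≤ _ := by
          rw [mul_assoc]
          gcongr
          exact weight_le hL j
  have hsum : Summable fun j : ℕ => (1 : ℝ) / ((j : ℝ) + 1) ^ 2 :=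
    summable_of_sum_range_le (fun j => by positivity) sum_inv_sq_le_two
  have h2 : ∑' j : ℕ, (1 : ℝ) / ((j : ℝ) + 1) ^ 2 ≤ 2 :=
    Real.tsum_le_of_sum_range_le (fun j => by positivity) sum_inv_sq_le_two
  have h3 := tsum_of_norm_bounded (hsum.mul_left (M * (L : ℝ) ^ L)).hasSum hterm
  rw [tsum_mul_left, Real.norm_eq_abs] at h3
  calc |eval f z| ≤ _ := h3
    _ ≤ M * (L : ℝ) ^ L * 2 := by gcongr
    _ = _ := by ring

end TimeSeries

/-! ### Super-exponentially small analytic data -/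

lemma iterExp_succ (N : ℕ) (x : ℝ) : iterExp (N + 1) x = Real.exp (iterExp N x) := rfl

lemma iterExp_le_succ (N : ℕ) (x : ℝ) : iterExp N x ≤ iterExp (N + 1) x := by
  rw [iterExp_succ]
  linarith [Real.add_one_le_exp (iterExp N x)]

lemma iterExp_mono_left {k N : ℕ} (h : k ≤ N) (x : ℝ) : iterExp k x ≤ iterExp N x :=
  monotone_nat_of_le_succ (f := fun k => iterExp k x) (fun k => iterExp_le_succ k x) h

lemma le_iterExp (N : ℕ) (x : ℝ) : x ≤ iterExp N x := iterExp_mono_left (Nat.zero_le N) x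

lemma iterExp_strictMono (N : ℕ) : StrictMono (iterExp N) := by
  induction N with
  | zero => exact fun x y h => h
  | succ N ih => exact fun x y h => Real.exp_lt_exp.2 (ih h)

lemma contDiff_iterExp (N : ℕ) : ContDiff ℝ ∞ (iterExp N) := by
  induction N with
  | zero => exact contDiff_id
  | succ N ih => exact Real.contDiff_exp.comp ih

/-- The iterated exponential of a complex variable. -/
noncomputable def cIterExp : ℕ → ℂ → ℂ
  | 0, z => z
  | N + 1, z => Complex.exp (cIterExp N z)

lemma cIterExp_ofReal (N : ℕ) (x : ℝ) : cIterExp N x = (iterExp N x : ℂ) := by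
  induction N with
  | zero => rfl
  | succ N ih => rw [cIterExp, ih, iterExp_succ, Complex.ofReal_exp]

lemma differentiable_cIterExp (N : ℕ) : Differentiable ℂ (cIterExp N) := by
  induction N with
  | zero => exact differentiable_id
  | succ N ih => exact Complex.differentiable_exp.comp ih

lemma norm_cexp_sub_exp_le {z : ℂ} {x : ℝ} (h : ‖z - x‖ ≤ 1) :
    ‖Complex.exp z - (Real.exp x : ℂ)‖ ≤ Real.exp x * (2 * ‖z - x‖) := by
  have h1 : Complex.exp z - (Real.exp x : ℂ) = Real.exp x * (Complex.exp (z - x) - 1) := by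
    rw [mul_sub, Complex.ofReal_exp, ← Complex.exp_add]
    simp
  rw [h1, norm_mul, Complex.norm_real, Real.norm_of_nonneg (Real.exp_pos x).le]
  gcongr
  exact Complex.norm_exp_sub_one_le h

/-- Each exponential multiplies the deviation from the real orbit by at most `2X`, as long as the
deviation stays below `1`; the hypothesis on `z` ensures this up to level `K`. -/
lemma norm_cIterExp_sub_le {K : ℕ} {σ X : ℝ} {z : ℂ} (hX : 1 ≤ X) (hσ : iterExp K σ ≤ X)
    (hz : ‖z - σ‖ * (2 * X) ^ K ≤ 1 / 4) {j : ℕ} (hj : j ≤ K) :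
    ‖cIterExp j z - iterExp j σ‖ ≤ ‖z - σ‖ * (2 * X) ^ j := by
  induction j with
  | zero => simp [cIterExp, iterExp]
  | succ j ih =>
    have h1 := ih (by omega)
    have h2 : ‖z - σ‖ * (2 * X) ^ j ≤ ‖z - σ‖ * (2 * X) ^ K := by
      gcongr
      · linarith
      · omega
    have h3 := norm_cexp_sub_exp_le (z := cIterExp j z) (x := iterExp j σ) (by linarith)
    rw [cIterExp, iterExp_succ]
    have h4 : Real.exp (iterExp j σ) ≤ X := (iterExp_mono_left hj σ).trans hσ
    calc _ ≤ Real.exp (iterExp j σ) * (2 * ‖cIterExp j z - iterExp j σ‖) := h3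
      _ ≤ X * (2 * (‖z - σ‖ * (2 * X) ^ j)) := by gcongr
      _ = _ := by ring

/-- At level `K` the deviation is at most `1/4`, so at level `K + 1` it is at most half of the real
value. The real part thus keeps at least half of its size on the whole complex disc. -/
lemma norm_cexp_neg_cIterExp_le {K : ℕ} {σ : ℝ} {z : ℂ} (hX : 1 ≤ iterExp K σ)
    (hz : ‖z - σ‖ * (2 * iterExp K σ) ^ K ≤ 1 / 4) :
    ‖Complex.exp (-cIterExp (K + 1) z)‖ ≤ Real.exp (-(Real.exp (iterExp K σ) / 2)) := by
  have h1 := norm_cIterExp_sub_le hX le_rfl hz le_rfl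
  have h2 := norm_cexp_sub_exp_le (z := cIterExp K z) (x := iterExp K σ) (by linarith)
  rw [Complex.norm_exp]
  refine Real.exp_le_exp.2 ?_
  rw [Complex.neg_re, neg_le_neg_iff]
  have h3 := Complex.abs_re_le_norm (cIterExp (K + 1) z - (Real.exp (iterExp K σ) : ℂ))
  rw [Complex.sub_re, Complex.ofReal_re] at h3
  have h4 := (abs_le.1 h3).1
  have h5 : ‖cIterExp (K + 1) z - (Real.exp (iterExp K σ) : ℂ)‖ ≤ Real.exp (iterExp K σ) / 2 := by
    calc _ ≤ Real.exp (iterExp K σ) * (2 * ‖cIterExp K z - iterExp K σ‖) := h2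
      _ ≤ Real.exp (iterExp K σ) * (2 * (1 / 4)) := by
          gcongr
          exact h1.trans hz
      _ = _ := by ring
  linarith

lemma iteratedDeriv_eq_re {G : ℂ → ℂ} {g : ℝ → ℝ} (hG : Differentiable ℂ G)
    (hg : ∀ x : ℝ, g x = (G x).re) (i : ℕ) (x : ℝ) :
    iteratedDeriv i g x = (iteratedDeriv i G x).re := by
  induction i generalizing x with
  | zero => simpa using hg x
  | succ i ih =>
    rw [iteratedDeriv_succ, iteratedDeriv_succ, show iteratedDeriv i g
      = fun x : ℝ => (iteratedDeriv i G x).re from funext ih]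
    have h1 : Differentiable ℂ (iteratedDeriv i G) :=
      (hG.contDiff (n := ∞)).differentiable_iteratedDeriv i (by exact_mod_cast WithTop.coe_lt_top _)
    exact (h1 x).hasDerivAt.real_of_complex.deriv

lemma abs_iteratedDeriv_le {G : ℂ → ℂ} {g : ℝ → ℝ} (hG : Differentiable ℂ G)
    (hg : ∀ x : ℝ, g x = (G x).re) {x R C : ℝ} (hR : 0 < R)
    (hC : ∀ z : ℂ, ‖z - x‖ ≤ R → ‖G z‖ ≤ C) (i : ℕ) :
    |iteratedDeriv i g x| ≤ i.factorial * C / R ^ i := by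
  rw [iteratedDeriv_eq_re hG hg]
  refine (Complex.abs_re_le_norm _).trans ?_
  refine Complex.norm_iteratedDeriv_le_of_forall_mem_sphere_norm_le i hR hG.diffContOnCl ?_
  intro z hz
  exact hC z (by rw [mem_sphere_iff_norm] at hz; exact hz.le)

/-! ### The initial data and their derivatives -/

/-- The exponent `exp (-e^{∘(K+1)} (τ + S))` of the initial data. -/
noncomputable def smallExp (K : ℕ) (S τ : ℝ) : ℝ := Real.exp (-iterExp (K + 1) (τ + S))

/-- The data `c (exp (± smallExp) - 1)`. -/
noncomputable def expData (K : ℕ) (S c s τ : ℝ) : ℝ := c * (Real.exp (s * smallExp K S τ) - 1)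

lemma contDiff_expData (K : ℕ) (S c s : ℝ) : ContDiff ℝ ∞ (expData K S c s) := by
  have h1 : ContDiff ℝ ∞ fun τ : ℝ => iterExp (K + 1) (τ + S) :=
    (contDiff_iterExp (K + 1)).comp (contDiff_id.add contDiff_const)
  exact contDiff_const.mul ((Real.contDiff_exp.comp
    (contDiff_const.mul (Real.contDiff_exp.comp h1.neg))).sub contDiff_const)

/-- Cauchy's estimates on the disc of radius `R` about `τ`. This disc lies within distance `2R` of
`τ₁`, so the bound is uniform over `|τ - τ₁| ≤ R`. -/
lemma abs_iteratedDeriv_expData_le {K : ℕ} {S c s τ₁ τ R : ℝ} (hs : |s| ≤ 1)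
    (hX : 1 ≤ iterExp K (τ₁ + S)) (hR0 : 0 < R) (hτ : |τ - τ₁| ≤ R)
    (hR : 2 * R * (2 * iterExp K (τ₁ + S)) ^ K ≤ 1 / 4) (i : ℕ) :
    |iteratedDeriv i (expData K S c s) τ| ≤
      i.factorial * (|c| * (2 * Real.exp (-(Real.exp (iterExp K (τ₁ + S)) / 2)))) / R ^ i := by
  have hX0 : 0 ≤ (2 * iterExp K (τ₁ + S)) ^ K := by positivity
  refine abs_iteratedDeriv_le
    (G := fun z => c * (Complex.exp (s * Complex.exp (-cIterExp (K + 1) (z + S))) - 1))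
    ?_ ?_ hR0 ?_ i
  · have h1 : Differentiable ℂ fun z : ℂ => cIterExp (K + 1) (z + S) :=
      (differentiable_cIterExp (K + 1)).comp (differentiable_id.add (differentiable_const _))
    exact (differentiable_const _).mul ((Complex.differentiable_exp.comp
      ((differentiable_const _).mul (Complex.differentiable_exp.comp h1.neg))).sub
        (differentiable_const _))
  · intro x
    have h1 : (c : ℂ) * (Complex.exp (s * Complex.exp (-cIterExp (K + 1) (x + S))) - 1)
        = (expData K S c s x : ℂ) := by
      rw [← Complex.ofReal_add, cIterExp_ofReal]
      simp [expData, smallExp]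
    rw [h1, Complex.ofReal_re]
  · intro z hz
    have h1 : ‖z + S - ((τ₁ + S : ℝ) : ℂ)‖ ≤ 2 * R := by
      have : z + S - ((τ₁ + S : ℝ) : ℂ) = (z - τ) + ((τ - τ₁ : ℝ) : ℂ) := by push_cast; ring
      rw [this]
      refine (norm_add_le _ _).trans ?_
      rw [Complex.norm_real, Real.norm_eq_abs]
      linarith
    have h2 := norm_cexp_neg_cIterExp_le (z := z + S) hX
      ((mul_le_mul_of_nonneg_right h1 hX0).trans hR)
    set w := Complex.exp (-cIterExp (K + 1) (z + S)) with hw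
    have h3 : ‖(s : ℂ) * w‖ ≤ Real.exp (-(Real.exp (iterExp K (τ₁ + S)) / 2)) := by
      rw [norm_mul, Complex.norm_real, Real.norm_eq_abs]
      calc |s| * ‖w‖ ≤ 1 * ‖w‖ := by gcongr
        _ ≤ _ := by rw [one_mul]; exact h2
    have h4 : Real.exp (-(Real.exp (iterExp K (τ₁ + S)) / 2)) ≤ 1 :=
      Real.exp_le_one_iff.2 (by have := Real.exp_pos (iterExp K (τ₁ + S)); linarith)
    rw [norm_mul, Complex.norm_real, Real.norm_eq_abs]
    gcongr
    exact (Complex.norm_exp_sub_one_le (h3.trans h4)).trans (by gcongr)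

/-- Factorial growth of derivatives is dominated by the majorants. -/
lemma mul_pow_le_factorial_of_le {d C R a M : ℝ} {i : ℕ} (hC : 0 ≤ C) (hR : 0 < R) (ha : 0 ≤ a)
    (hd : d ≤ i.factorial * C / R ^ i) (hCM : C * Real.exp (Real.exp 8 * (a / R)) ≤ M) :
    d * a ^ i ≤ (2 * i).factorial * (M * (1 / ((2 * i : ℕ) + 1) ^ 4)) := by
  -- Cauchy's estimate uses one factor `i!` while `(2i)!` offers two. The spare one absorbs the
  -- geometric growth `(a/R)^i` at the cost of an exponential, in which `exp 8 ^ i` accounts for the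
  -- weight `(2i + 1)⁴`.
  have hκ : 0 ≤ a / R := by positivity
  have h1 : ((i.factorial : ℝ)) * i.factorial ≤ (2 * i).factorial := by
    rw [two_mul]
    exact_mod_cast Nat.le_of_dvd (Nat.factorial_pos _)
      (Nat.factorial_mul_factorial_dvd_factorial_add i i)
  have h2 : (((2 * i : ℕ) : ℝ) + 1) ^ 4 ≤ Real.exp 8 ^ i := by
    have : (((2 * i : ℕ) : ℝ) + 1) ≤ Real.exp (2 * i) := by
      have := Real.add_one_le_exp (2 * i : ℝ)
      push_cast
      linarith
    calc _ ≤ Real.exp (2 * i) ^ 4 := by gcongr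
      _ = Real.exp 8 ^ i := by
          rw [← Real.exp_nat_mul, ← Real.exp_nat_mul]; congr 1; push_cast; ring
  have h3 : (Real.exp 8 * (a / R)) ^ i ≤ i.factorial * Real.exp (Real.exp 8 * (a / R)) := by
    have := Real.pow_div_factorial_le_exp (Real.exp 8 * (a / R)) (by positivity) i
    rw [div_le_iff₀ (by positivity)] at this
    linarith
  rw [← mul_assoc, mul_one_div, le_div_iff₀ (by positivity)]
  have hM : 0 ≤ M := le_trans (by positivity) hCM
  calc d * a ^ i * (((2 * i : ℕ) : ℝ) + 1) ^ 4
      ≤ (i.factorial * C / R ^ i) * a ^ i * Real.exp 8 ^ i := by gcongr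
    _ = i.factorial * C * (Real.exp 8 * (a / R)) ^ i := by
        rw [mul_pow, div_pow]; field_simp
    _ ≤ i.factorial * C * (i.factorial * Real.exp (Real.exp 8 * (a / R))) := by gcongr
    _ = (i.factorial * i.factorial) * (C * Real.exp (Real.exp 8 * (a / R))) := by ring
    _ ≤ _ := by gcongr

lemma exists_forall_mul_pow_le_exp (C : ℝ) (p : ℕ) :
    ∃ X₀ : ℝ, 1 ≤ X₀ ∧ ∀ X, X₀ ≤ X → C * X ^ p ≤ Real.exp X / 2 := by
  have h1 := (Real.isLittleO_pow_exp_atTop (n := p)).def (c := 1 / (2 * (|C| + 1))) (by positivity)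
  obtain ⟨X₀, hX₀⟩ := Filter.eventually_atTop.1 h1
  refine ⟨max X₀ 1, le_max_right _ _, fun X hX => ?_⟩
  have h2 := hX₀ X ((le_max_left _ _).trans hX)
  have hX1 : 1 ≤ X := (le_max_right _ _).trans hX
  rw [Real.norm_of_nonneg (by positivity), Real.norm_of_nonneg (by positivity)] at h2
  calc C * X ^ p ≤ (|C| + 1) * X ^ p := by gcongr; linarith [le_abs_self C]
    _ ≤ (|C| + 1) * (1 / (2 * (|C| + 1)) * Real.exp X) := by gcongr
    _ = Real.exp X / 2 := by field_simp

/-! ### The profile function -/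

section Parameters

variable (m : ℕ) (b : ℝ)

/-- The number of growing weights. -/
noncomputable def weightLength : ℕ := ⌈81 * (8 * ((m : ℝ) + 1) * b ^ 2)⌉₊

/-- The size of the majorant. -/
noncomputable def majSize : ℝ :=
  (32000 * b ^ 2 * (weightLength m b : ℝ) ^ (weightLength m b + 3))⁻¹

variable {m b}

lemma one_le_weightLength (hb : 1 ≤ b) : 1 ≤ weightLength m b :=
  Nat.one_le_ceil_iff.2 (by positivity)

lemma majSize_nonneg : 0 ≤ majSize m b := by unfold majSize; positivity

lemma majSize_mul_le (hb : 1 ≤ b) :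
    16 * majSize m b * (2000 * (weightLength m b : ℝ) ^ (weightLength m b + 3)) ≤ 1 := by
  have hL : (0 : ℝ) < weightLength m b := by exact_mod_cast one_le_weightLength (m := m) hb
  have hb2 : 1 ≤ b ^ 2 := one_le_pow₀ hb
  unfold majSize
  calc _ = (b ^ 2)⁻¹ := by field_simp; norm_num
    _ ≤ 1 := inv_le_one_of_one_le₀ hb2

/-- The factor `b²` in `majSize` is there for this bound: it yields the decay `b⁻²` of the sum on
`|y| ≤ b`. -/
lemma two_mul_majSize_mul_le (hb : 1 ≤ b) :
    2 * (majSize m b * (weightLength m b : ℝ) ^ weightLength m b) ≤ (b ^ 2)⁻¹ := by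
  have hL1 : (1 : ℝ) ≤ weightLength m b := by exact_mod_cast one_le_weightLength (m := m) hb
  have hL3 : (1 : ℝ) ≤ (weightLength m b : ℝ) ^ 3 := one_le_pow₀ hL1
  unfold majSize
  rw [pow_add]
  calc _ = (b ^ 2)⁻¹ * (1 / (16000 * (weightLength m b : ℝ) ^ 3)) := by field_simp; norm_num
    _ ≤ (b ^ 2)⁻¹ * 1 := by
        gcongr
        rw [div_le_one (by positivity)]
        linarith
    _ = _ := mul_one _

/-- The shift `S` may be chosen so that the data are small compared with the majorants. -/
lemma exists_shift (m N : ℕ) (ρ : ℝ) (hρ : 0 ≤ ρ) : ∃ S : ℝ, 1 ≤ S ∧ ∀ σ, S ≤ σ →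
    ρ * (2 * Real.exp (-(Real.exp (iterExp (N + 1) σ) / 2))) *
      Real.exp (Real.exp 8 * ((8 * iterExp N σ ^ 2) /
        (1 / (8 * (2 * iterExp (N + 1) σ) ^ (N + 1))))) ≤ majSize m (iterExp N σ) := by
  -- In terms of `X = e^{∘(N+1)}(σ)` one has `b ≤ X`, `L ≤ A X²`, hence `L^(L+3) ≤ exp(A(A+3)X⁴)`,
  -- and the exponent coming from `a/R` is at most `B X^(N+3)`. All of these lose against the factor
  -- `exp(-e^X/2)` of the data.
  set A : ℝ := 81 * (8 * ((m : ℝ) + 1)) + 1 with hA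
  set B : ℝ := Real.exp 8 * (64 * 2 ^ (N + 1)) with hB
  obtain ⟨X₀, hX₀, hX⟩ := exists_forall_mul_pow_le_exp
    (64000 * ρ + 2 + A * (A + 3) + B) (N + 5)
  refine ⟨X₀, hX₀, fun σ hσ => ?_⟩
  have hb1 : 1 ≤ iterExp N σ := (hX₀.trans hσ).trans (le_iterExp N σ)
  have hbX : iterExp N σ ≤ iterExp (N + 1) σ := iterExp_le_succ N σ
  have hmain := hX (iterExp (N + 1) σ) (hσ.trans (le_iterExp (N + 1) σ))
  set b := iterExp N σ with hb
  set X := iterExp (N + 1) σ with hXdef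
  have hX1 : 1 ≤ X := hb1.trans hbX
  set L := weightLength m b with hL
  have hL1 : (1 : ℝ) ≤ L := by exact_mod_cast one_le_weightLength (m := m) hb1
  have hA1 : 1 ≤ A := by rw [hA]; have : (0 : ℝ) ≤ m := m.cast_nonneg; linarith
  have hLA : (L : ℝ) ≤ A * X ^ 2 := by
    have h1 : (L : ℝ) < 81 * (8 * ((m : ℝ) + 1) * b ^ 2) + 1 := Nat.ceil_lt_add_one (by positivity)
    have h2 : b ^ 2 ≤ X ^ 2 := by gcongr
    have h3 : 1 ≤ X ^ 2 := one_le_pow₀ hX1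
    have h4 : 81 * (8 * ((m : ℝ) + 1) * b ^ 2) ≤ 81 * (8 * ((m : ℝ) + 1) * X ^ 2) := by gcongr
    rw [hA]
    linarith
  have hLpow : (L : ℝ) ^ (L + 3) ≤ Real.exp (A * (A + 3) * X ^ 4) := by
    have h1 : (L : ℝ) ≤ Real.exp L := by linarith [Real.add_one_le_exp (L : ℝ)]
    have h3 : 1 ≤ X ^ 2 := one_le_pow₀ hX1
    calc (L : ℝ) ^ (L + 3) ≤ Real.exp L ^ (L + 3) := by gcongr
      _ = Real.exp (((L : ℝ) + 3) * L) := by rw [← Real.exp_nat_mul]; push_cast; rfl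
      _ ≤ Real.exp ((A * X ^ 2 + 3 * X ^ 2) * (A * X ^ 2)) := by
          gcongr
          linarith
      _ = _ := by congr 1; ring
  have hb2 : b ^ 2 ≤ Real.exp (2 * X) := by
    have h1 : X ≤ Real.exp X := by linarith [Real.add_one_le_exp X]
    calc b ^ 2 ≤ Real.exp X ^ 2 := by gcongr; linarith
      _ = _ := by rw [← Real.exp_nat_mul]; norm_num
  have hρe : 64000 * ρ ≤ Real.exp (64000 * ρ) := by
    linarith [Real.add_one_le_exp (64000 * ρ)]
  have hκ : Real.exp 8 * ((8 * b ^ 2) / (1 / (8 * (2 * X) ^ (N + 1)))) ≤ B * X ^ (N + 3) := by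
    have h2 : b ^ 2 ≤ X ^ 2 := by gcongr
    calc _ = Real.exp 8 * (64 * 2 ^ (N + 1)) * (X ^ (N + 1) * b ^ 2) := by
          rw [mul_pow]; field_simp; ring
      _ ≤ Real.exp 8 * (64 * 2 ^ (N + 1)) * (X ^ (N + 1) * X ^ 2) := by gcongr
      _ = _ := by rw [hB, ← pow_add]
  have hB0 : 0 ≤ B := by positivity
  have hsum : 64000 * ρ + 2 * X + A * (A + 3) * X ^ 4 + B * X ^ (N + 3)
      ≤ Real.exp X / 2 := by
    refine le_trans ?_ hmain
    have e1 : 1 ≤ X ^ (N + 5) := one_le_pow₀ hX1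
    have e2 : X ≤ X ^ (N + 5) := le_self_pow₀ hX1 (by omega)
    have e3 : X ^ 4 ≤ X ^ (N + 5) := pow_le_pow_right₀ hX1 (by omega)
    have e4 : X ^ (N + 3) ≤ X ^ (N + 5) := pow_le_pow_right₀ hX1 (by omega)
    have f1 : 64000 * ρ * 1 ≤ 64000 * ρ * X ^ (N + 5) := by gcongr
    have f3 : A * (A + 3) * X ^ 4 ≤ A * (A + 3) * X ^ (N + 5) := by gcongr
    have f4 : B * X ^ (N + 3) ≤ B * X ^ (N + 5) := by gcongr
    linarith
  have hD : 0 < 32000 * b ^ 2 * (L : ℝ) ^ (L + 3) := by positivity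
  unfold majSize
  rw [← hL]
  refine le_of_mul_le_mul_right ?_ hD
  rw [inv_mul_cancel₀ hD.ne']
  calc _ = (64000 * ρ) * b ^ 2 * (L : ℝ) ^ (L + 3) *
        Real.exp (Real.exp 8 * ((8 * b ^ 2) / (1 / (8 * (2 * X) ^ (N + 1))))) *
        Real.exp (-(Real.exp X / 2)) := by ring
    _ ≤ Real.exp (64000 * ρ) * Real.exp (2 * X) * Real.exp (A * (A + 3) * X ^ 4) *
        Real.exp (B * X ^ (N + 3)) * Real.exp (-(Real.exp X / 2)) := by gcongr
    _ = Real.exp (64000 * ρ + 2 * X + A * (A + 3) * X ^ 4 + B * X ^ (N + 3)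
        + -(Real.exp X / 2)) := by
        rw [← Real.exp_add, ← Real.exp_add, ← Real.exp_add, ← Real.exp_add]
    _ ≤ 1 := Real.exp_le_one_iff.2 (by linarith)

end Parameters

/-- On the open set `O`, the function `U (y, τ)` is a smooth solution of the equation for graphs
over the cylinder of radius `cylRadius m` that depend on one axial coordinate `y` only; `U_y`,
`U_yy` and `U_t` are its derivatives. -/
structure IsGraphProfile (m : ℕ) (O : Set (ℝ × ℝ)) (U U_y U_yy U_t : ℝ × ℝ → ℝ) : Prop where
  isOpen : IsOpen O
  contDiffOn : ContDiffOn ℝ ∞ U O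
  lt : ∀ z ∈ O, -cylRadius m < U z
  hasFDerivAt : ∀ z ∈ O, HasFDerivAt U (U_y z • ContinuousLinearMap.fst ℝ ℝ ℝ +
    U_t z • ContinuousLinearMap.snd ℝ ℝ ℝ) z
  hasDerivAt : ∀ z ∈ O, HasDerivAt (fun y => U_y (y, z.2)) (U_yy z) z.1
  equation : ∀ z ∈ O, U_yy z = (1 + U_y z ^ 2) * (U_t z + m / (cylRadius m + U z)
    - (cylRadius m + U z) / 2 + z.1 * U_y z / 2)

open TimeSeries in
/-- A solution of the rotationally symmetric graph equation over an expanding region, which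
converges to zero super-exponentially and does not vanish on the axis. -/
theorem exists_profile (m N : ℕ) (hm : 1 ≤ m) :
    ∃ (O : Set (ℝ × ℝ)) (U U_y U_yy U_t : ℝ × ℝ → ℝ), IsGraphProfile m O U U_y U_yy U_t ∧
      (∀ y τ : ℝ, 0 ≤ τ → |y| ≤ iterExp N τ → (y, τ) ∈ O) ∧
      (∀ τ : ℝ, U (0, τ) ≠ 0) ∧
      (∀ ε : ℝ, 0 < ε → ∃ T : ℝ, 0 ≤ T ∧ ∀ τ : ℝ, T ≤ τ → ∀ y : ℝ, |y| ≤ iterExp N τ →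
        |U (y, τ)| * iterExp N τ < ε) := by
  set ρ := cylRadius m with hρdef
  have hm' : (1 : ℝ) ≤ m := by exact_mod_cast hm
  have hρsq : ρ ^ 2 = 2 * m := Real.sq_sqrt (by positivity)
  have hρ : 4 / 3 ≤ ρ := Real.le_sqrt_of_sq_le (by norm_num; linarith)
  have hρ0 : 0 < ρ := by linarith
  obtain ⟨S, hS1, hS⟩ := exists_shift m N ρ hρ0.le
  -- The exponential form of the data makes `ρ + g` and `ρ⁻¹ + h` exact reciprocals, while both `g`
  -- and `h` remain restrictions of entire functions.
  set g := expData (N + 1) S ρ 1 with hg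
  set h := expData (N + 1) S ρ⁻¹ (-1) with hh
  have hgs : ContDiff ℝ ∞ g := contDiff_expData _ _ _ _
  have hhs : ContDiff ℝ ∞ h := contDiff_expData _ _ _ _
  have hgh : ∀ τ, (ρ⁻¹ + h τ) * (ρ + g τ) = 1 := by
    intro τ
    have h1 : ρ⁻¹ + h τ = ρ⁻¹ * Real.exp (-smallExp (N + 1) S τ) := by
      simp only [hh, expData]; ring_nf
    have h2 : ρ + g τ = ρ * Real.exp (smallExp (N + 1) S τ) := by
      simp only [hg, expData]; ring_nf
    rw [h1, h2, Real.exp_neg]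
    have := Real.exp_pos (smallExp (N + 1) S τ)
    field_simp
  set u := (formalSol m ρ g h).1 with hu
  set v := (formalSol m ρ g h).2 with hv
  obtain ⟨hsu, hsv⟩ : SmoothCoeffs u ∧ SmoothCoeffs v := smoothCoeffs_formalSol hgs hhs
  -- This radius makes `2 R (2X)^(N+1)` equal to `1/4`, the limit allowed for the complex iterated
  -- exponential.
  set R : ℝ → ℝ := fun τ₁ => 1 / (8 * (2 * iterExp (N + 1) (τ₁ + S)) ^ (N + 1)) with hR
  set b : ℝ → ℝ := fun τ₁ => iterExp N (τ₁ + S) with hb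
  have hb1 : ∀ τ₁, 0 ≤ τ₁ → 1 ≤ b τ₁ := fun τ₁ h0 =>
    (by linarith : 1 ≤ τ₁ + S).trans (le_iterExp N _)
  have hX1 : ∀ τ₁, 0 ≤ τ₁ → 1 ≤ iterExp (N + 1) (τ₁ + S) := fun τ₁ h0 =>
    (hb1 τ₁ h0).trans (iterExp_le_succ N _)
  have hR0 : ∀ τ₁, 0 ≤ τ₁ → 0 < R τ₁ := fun τ₁ h0 => by
    have := hX1 τ₁ h0
    simp only [hR]
    positivity
  have hdata : ∀ τ₁, 0 ≤ τ₁ → ∀ τ, |τ - τ₁| ≤ R τ₁ → ∀ c s : ℝ, |c| ≤ ρ → |s| ≤ 1 → ∀ i,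
      |iteratedDeriv i (expData (N + 1) S c s) τ| * (8 * b τ₁ ^ 2) ^ i ≤ (2 * i).factorial *
        (majSize m (b τ₁) * weight (weightLength m (b τ₁)) (2 * i)) := by
    intro τ₁ h0 τ hτ c s hc hs i
    have h1 := hX1 τ₁ h0
    have h2 : 2 * R τ₁ * (2 * iterExp (N + 1) (τ₁ + S)) ^ (N + 1) ≤ 1 / 4 := by
      refine le_of_eq ?_
      simp only [hR]
      field_simp
      norm_num
    have h3 := abs_iteratedDeriv_expData_le (c := c) hs h1 (hR0 τ₁ h0) hτ h2 i
    have h4 := hS (τ₁ + S) (by linarith)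
    have h5 := mul_pow_le_factorial_of_le (a := 8 * b τ₁ ^ 2) (M := majSize m (b τ₁))
      (by positivity) (hR0 τ₁ h0) (by positivity) h3
      (le_trans (by gcongr) h4)
    refine h5.trans ?_
    have h6 := majSize_nonneg (m := m) (b := b τ₁)
    gcongr
    unfold weight
    gcongr
    exact one_le_growth (one_le_weightLength (hb1 τ₁ h0)) _
  -- Hence the shift `S`, chosen for the amplitude `ρ`, also serves the data `h` of amplitude `ρ⁻¹`.
  have hρi : |ρ⁻¹| ≤ ρ := by
    rw [abs_of_pos (by positivity)]
    exact (inv_le_one_of_one_le₀ (by linarith)).trans (by linarith)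
  -- One and the same formal solution is majorized near every `τ₁`, with constants depending on
  -- `τ₁`. The sums on different boxes are thus values of one function, and nothing has to be glued.
  have hmaj : ∀ τ₁, 0 ≤ τ₁ → ∀ τ, |τ - τ₁| ≤ R τ₁ →
      (Maj (8 * b τ₁ ^ 2) (b τ₁) τ u fun n =>
        majSize m (b τ₁) * weight (weightLength m (b τ₁)) n) ∧
      (Maj (8 * b τ₁ ^ 2) (b τ₁) τ v fun n =>
        majSize m (b τ₁) * weight (weightLength m (b τ₁)) n) := by
    intro τ₁ h0 τ hτ
    exact maj_formalSol (by positivity) hρ (hb1 τ₁ h0) (one_le_weightLength (hb1 τ₁ h0))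
      (Nat.le_ceil _) majSize_nonneg (majSize_mul_le (hb1 τ₁ h0)) hgs hhs
      (hdata τ₁ h0 τ hτ ρ 1 (abs_of_pos hρ0).le (by simp))
      (hdata τ₁ h0 τ hτ ρ⁻¹ (-1) hρi (by simp))
  have hsmall : ∀ τ₁, 0 ≤ τ₁ → ∀ z : ℝ × ℝ, |z.2 - τ₁| ≤ R τ₁ → |z.1| ≤ b τ₁ →
      |eval u z| ≤ (b τ₁ ^ 2)⁻¹ := fun τ₁ h0 z hz hz' =>
    (abs_eval_le_of_maj majSize_nonneg (one_le_weightLength (hb1 τ₁ h0))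
      (hmaj τ₁ h0 z.2 hz).1 hz').trans (two_mul_majSize_mul_le (hb1 τ₁ h0))
  set I : ℝ → Set ℝ := fun τ₁ => Metric.ball τ₁ (R τ₁) with hI
  have hregu : ∀ τ₁, 0 ≤ τ₁ → Regular (b τ₁) (I τ₁) u ∧ Regular (b τ₁) (I τ₁) v := by
    intro τ₁ h0
    have hb0 : 0 < b τ₁ := by linarith [hb1 τ₁ h0]
    have hIR : ∀ τ ∈ I τ₁, |τ - τ₁| ≤ R τ₁ := fun τ hτ => by
      rw [hI, Metric.mem_ball, Real.dist_eq] at hτ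
      exact hτ.le
    exact ⟨regular_of_maj (by positivity) hb0 majSize_nonneg (one_le_weightLength (hb1 τ₁ h0)) hsu
        fun τ hτ => (hmaj τ₁ h0 τ (hIR τ hτ)).1,
      regular_of_maj (by positivity) hb0 majSize_nonneg (one_le_weightLength (hb1 τ₁ h0)) hsv
        fun τ hτ => (hmaj τ₁ h0 τ (hIR τ hτ)).2⟩
  have hIo : ∀ τ₁, IsOpen (I τ₁) := fun τ₁ => Metric.isOpen_ball
  have hIc : ∀ τ₁, IsPreconnected (I τ₁) := fun τ₁ => (convex_ball _ _).isPreconnected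
  have hbox : ∀ τ₁, IsOpen (Metric.ball (0 : ℝ) (b τ₁) ×ˢ I τ₁) := fun τ₁ =>
    Metric.isOpen_ball.prod (hIo τ₁)
  have hmem : ∀ z ∈ ⋃ τ₁ ∈ Set.Ici (0 : ℝ), Metric.ball (0 : ℝ) (b τ₁) ×ˢ I τ₁,
      ∃ τ₁, 0 ≤ τ₁ ∧ |z.1| < b τ₁ ∧ z.2 ∈ I τ₁ := by
    intro z hz
    obtain ⟨τ₁, h0, hz⟩ := Set.mem_iUnion₂.1 hz
    exact ⟨τ₁, h0, by simpa using hz.1, hz.2⟩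
  have hUgt : ∀ τ₁, 0 ≤ τ₁ → ∀ z : ℝ × ℝ, |z.1| < b τ₁ → z.2 ∈ I τ₁ → -ρ < eval u z := by
    intro τ₁ h0 z hz1 hz2
    rw [hI, Metric.mem_ball, Real.dist_eq] at hz2
    have hb2 : (b τ₁ ^ 2)⁻¹ ≤ 1 := inv_le_one_of_one_le₀ (one_le_pow₀ (hb1 τ₁ h0))
    linarith [(abs_le.1 (hsmall τ₁ h0 z hz2.le hz1.le)).1]
  refine ⟨⋃ τ₁ ∈ Set.Ici (0 : ℝ), Metric.ball (0 : ℝ) (b τ₁) ×ˢ I τ₁, eval u, eval (dy u),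
    eval (dy (dy u)), eval (dt u), ⟨isOpen_biUnion fun τ₁ _ => hbox τ₁, ?_, ?_, ?_, ?_, ?_⟩,
    ?_, ?_, ?_⟩
  · intro z hz
    obtain ⟨τ₁, h0, hz⟩ := Set.mem_iUnion₂.1 hz
    exact (((hregu τ₁ h0).1.contDiffOn_eval (hIo τ₁) (hIc τ₁)).contDiffAt
      ((hbox τ₁).mem_nhds hz)).contDiffWithinAt
  · intro z hz
    obtain ⟨τ₁, h0, hz1, hz2⟩ := hmem z hz
    exact hUgt τ₁ h0 z hz1 hz2
  · intro z hz
    obtain ⟨τ₁, h0, hz1, hz2⟩ := hmem z hz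
    exact (hregu τ₁ h0).1.hasFDerivAt_eval (hIo τ₁) (hIc τ₁) hz1 hz2
  · intro z hz
    obtain ⟨τ₁, h0, hz1, hz2⟩ := hmem z hz
    have h1 : HasFDerivAt (eval (dy u)) (Regular.evalDeriv (dy u) z) (z.1, z.2) :=
      (hregu τ₁ h0).1.dy.hasFDerivAt_eval (hIo τ₁) (hIc τ₁) hz1 hz2
    have h2 : HasDerivAt (fun y : ℝ => (y, z.2)) ((1 : ℝ), (0 : ℝ)) z.1 :=
      (hasDerivAt_id z.1).prodMk (hasDerivAt_const z.1 z.2)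
    refine (h1.comp_hasDerivAt z.1 h2).congr_deriv ?_
    simp [Regular.evalDeriv]
  · intro z hz
    obtain ⟨τ₁, h0, hz1, hz2⟩ := hmem z hz
    obtain ⟨hru, hrv⟩ := hregu τ₁ h0
    have hUz := hUgt τ₁ h0 z hz1 hz2
    have au := hru.absConv hz1 hz2
    have av := hrv.absConv hz1 hz2
    have auy := hru.dy.absConv hz1 hz2
    have aut := hru.dt.absConv hz1 hz2
    have aX := AbsConv.X z
    have hc : ∀ c : ℝ, AbsConv (const c) z := fun c => AbsConv.const c z
    have hinv := congrArg (fun f => eval f z) (formalSol_inverse (m := (m : ℝ)) hgh)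
    rw [← hu, ← hv] at hinv
    rw [eval_mul ((hc _).add av) ((hc _).add au), eval_add (hc _) av, eval_add (hc _) au,
      eval_const, eval_const, eval_one] at hinv
    have hpde := congrArg (fun f => eval f z)
      (dy_dy_formalSol_fst (m := (m : ℝ)) (ρ := ρ) (g := g) (h := h))
    rw [← hu, ← hv] at hpde
    simp only [graphRHS] at hpde
    rw [eval_mul ((AbsConv.one z).add (auy.mul auy))
        (((aut.add ((hc _).mul av)).sub ((hc _).mul au)).add ((hc _).mul (aX.mul auy))),
      eval_add (AbsConv.one z) (auy.mul auy), eval_mul auy auy, eval_one,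
      eval_add ((aut.add ((hc _).mul av)).sub ((hc _).mul au)) ((hc _).mul (aX.mul auy)),
      eval_sub (aut.add ((hc _).mul av)) ((hc _).mul au), eval_add aut ((hc _).mul av),
      eval_mul (hc _) av, eval_mul (hc _) au, eval_mul (hc _) (aX.mul auy), eval_mul aX auy,
      eval_const, eval_const, eval_X] at hpde
    have hr0 : ρ + eval u z ≠ 0 := by linarith
    have h1 : (m : ℝ) / (ρ + eval u z) = m * (ρ⁻¹ + eval v z) := by
      rw [div_eq_iff hr0, mul_assoc, hinv, mul_one]
    -- This is `ρ² = 2m`, the stationarity of the cylinder. It removes the constant term and reduces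
    -- `m/(ρ+u) - (ρ+u)/2` to `m v - u/2`.
    have h2 : (m : ℝ) * ρ⁻¹ = ρ / 2 := by
      field_simp
      linarith
    rw [hpde, h1, mul_add (m : ℝ) ρ⁻¹, h2]
    ring
  · intro y τ h0 hy
    refine Set.mem_biUnion (Set.mem_Ici.2 h0) ⟨?_, Metric.mem_ball_self (hR0 τ h0)⟩
    rw [mem_ball_zero_iff, Real.norm_eq_abs]
    -- The positive shift `S` makes the box strictly wider than the required region.
    exact hy.trans_lt (iterExp_strictMono N (by linarith))
  · intro τ
    rw [eval_fst_zero, hu, coeff_zero_formalSol_fst]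
    have h1 : 0 < smallExp (N + 1) S τ := Real.exp_pos _
    have h2 : 1 < Real.exp (1 * smallExp (N + 1) S τ) := Real.one_lt_exp_iff.2 (by linarith)
    simp only [hg, expData]
    have : 0 < Real.exp (1 * smallExp (N + 1) S τ) - 1 := by linarith
    positivity
  · intro ε hε
    -- From `τ ≥ ε⁻¹` follows `b τ ≥ τ + S > ε⁻¹`, and the quantity to be bounded is at most `(b
    -- τ)⁻² · b τ`.
    refine ⟨ε⁻¹, by positivity, fun τ hτ y hy => ?_⟩
    have h0 : 0 ≤ τ := le_trans (by positivity) hτ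
    have hlt : iterExp N τ < b τ := iterExp_strictMono N (by linarith)
    have hbpos : 0 < b τ := by linarith [hb1 τ h0]
    have h1 := hsmall τ h0 (y, τ) (by simpa using (hR0 τ h0).le) (hy.trans hlt.le)
    have h2 : ε⁻¹ < b τ := (by linarith : ε⁻¹ < τ + S).trans_le (le_iterExp N _)
    have h3 : (0 : ℝ) ≤ iterExp N τ := h0.trans (le_iterExp N τ)
    calc |eval u (y, τ)| * iterExp N τ ≤ (b τ ^ 2)⁻¹ * b τ := by gcongr
      _ = (b τ)⁻¹ := by field_simp
      _ < ε := inv_lt_of_inv_lt₀ hε h2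

/-! ### Mean curvature of hypersurfaces with a given normal vector -/

section Hypersurface

open scoped Topology InnerProductSpace

variable {n : ℕ} {E : Type*} [NormedAddCommGroup E] [InnerProductSpace ℝ E]
  {F : EuclideanSpace ℝ (Fin n) → E} {p : EuclideanSpace ℝ (Fin n)} {ν : E}

lemma tangentSpaceOf_eq_orthogonal (hdim : Module.finrank ℝ E = n + 1)
    (hinj : Function.Injective (fderiv ℝ F p)) (hν : ν ≠ 0)
    (hort : ∀ v, ⟪ν, fderiv ℝ F p v⟫_ℝ = 0) : tangentSpaceOf F p = (ℝ ∙ ν)ᗮ := by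
  have : Fact (Module.finrank ℝ E = n + 1) := ⟨hdim⟩
  have : FiniteDimensional ℝ E := Module.finite_of_finrank_eq_succ hdim
  refine Submodule.eq_of_le_of_finrank_eq ?_ ?_
  · rintro _ ⟨v, rfl⟩
    rw [Submodule.mem_orthogonal_singleton_iff_inner_right]
    exact hort v
  · rw [Submodule.finrank_orthogonal_span_singleton (n := n) hν, tangentSpaceOf,
      LinearMap.finrank_range_of_inj hinj, finrank_euclideanSpace, Fintype.card_fin]

lemma sub_smul_mem_tangentSpaceOf (hdim : Module.finrank ℝ E = n + 1)
    (hinj : Function.Injective (fderiv ℝ F p)) (hν : ν ≠ 0)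
    (hort : ∀ v, ⟪ν, fderiv ℝ F p v⟫_ℝ = 0) (w : E) :
    w - (⟪ν, w⟫_ℝ / ‖ν‖ ^ 2) • ν ∈ tangentSpaceOf F p := by
  rw [tangentSpaceOf_eq_orthogonal hdim hinj hν hort,
    Submodule.mem_orthogonal_singleton_iff_inner_right, inner_sub_right, inner_smul_right,
    real_inner_self_eq_norm_sq]
  have : ‖ν‖ ≠ 0 := norm_ne_zero_iff.2 hν
  field_simp
  ring

lemma normalPart_eq (hdim : Module.finrank ℝ E = n + 1)
    (hinj : Function.Injective (fderiv ℝ F p)) (hν : ν ≠ 0)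
    (hort : ∀ v, ⟪ν, fderiv ℝ F p v⟫_ℝ = 0) (w : E) :
    normalPart F p w = (⟪ν, w⟫_ℝ / ‖ν‖ ^ 2) • ν := by
  rw [normalPart, Submodule.eq_starProjection_of_mem_of_inner_eq_zero
    (sub_smul_mem_tangentSpaceOf hdim hinj hν hort w)]
  · simp
  · rintro _ ⟨v, rfl⟩
    rw [sub_sub_cancel, inner_smul_left]
    simp [hort v]

lemma isUnit_inducedMetric (hinj : Function.Injective (fderiv ℝ F p)) :
    IsUnit (inducedMetric F p) := by
  have h1 : LinearIndependent ℝ fun i => fderiv ℝ F p (EuclideanSpace.single i (1 : ℝ)) := by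
    have h2 := (EuclideanSpace.basisFun (Fin n) ℝ).toBasis.linearIndependent.map'
      (fderiv ℝ F p).toLinearMap (LinearMap.ker_eq_bot.2 hinj)
    have h3 : (fun i => fderiv ℝ F p (EuclideanSpace.single i (1 : ℝ)))
        = (fderiv ℝ F p).toLinearMap ∘ (EuclideanSpace.basisFun (Fin n) ℝ).toBasis := by
      ext i
      simp
    rw [h3]
    exact h2
  exact (Matrix.posDef_gram_iff_linearIndependent.2 h1).isUnit

/-- The inverse metric represents the orthogonal projection to the tangent space. -/
lemma sum_inv_inducedMetric (hdim : Module.finrank ℝ E = n + 1)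
    (hinj : Function.Injective (fderiv ℝ F p)) (hν : ν ≠ 0)
    (hort : ∀ v, ⟪ν, fderiv ℝ F p v⟫_ℝ = 0) (w : E) :
    ∑ i, ∑ j, (inducedMetric F p)⁻¹ i j *
      (⟪w, fderiv ℝ F p (EuclideanSpace.single i 1)⟫_ℝ *
        ⟪w, fderiv ℝ F p (EuclideanSpace.single j 1)⟫_ℝ)
      = ‖w‖ ^ 2 - ⟪ν, w⟫_ℝ ^ 2 / ‖ν‖ ^ 2 := by
  -- Here `c` is the coordinate vector of the tangential part of `w`. The Gram matrix sends `c` to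
  -- the products of `w` with the coordinate vectors, so the double sum collapses to the inner
  -- product of `w` with its tangential part.
  obtain ⟨c, hc⟩ := sub_smul_mem_tangentSpaceOf hdim hinj hν hort w
  have hc' : fderiv ℝ F p c = w - (⟪ν, w⟫_ℝ / ‖ν‖ ^ 2) • ν := hc
  have hsum : ∀ x : EuclideanSpace ℝ (Fin n), fderiv ℝ F p x
      = ∑ l, x l • fderiv ℝ F p (EuclideanSpace.single l 1) := by
    intro x
    conv_lhs => rw [← (EuclideanSpace.basisFun (Fin n) ℝ).sum_repr x]
    simp
  have hw : ∀ v, ⟪w, fderiv ℝ F p v⟫_ℝ = ⟪fderiv ℝ F p c, fderiv ℝ F p v⟫_ℝ := by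
    intro v
    rw [hc', inner_sub_left, inner_smul_left, hort v]
    simp
  have hmul : ∀ j, ⟪w, fderiv ℝ F p (EuclideanSpace.single j 1)⟫_ℝ
      = (inducedMetric F p).mulVec c j := by
    intro j
    rw [hw, hsum c, sum_inner, Matrix.mulVec, dotProduct]
    refine Finset.sum_congr rfl fun l _ => ?_
    rw [inner_smul_left, real_inner_comm, inducedMetric, Matrix.of_apply]
    simp [mul_comm]
  have hinvmul : (inducedMetric F p)⁻¹.mulVec ((inducedMetric F p).mulVec c) = c := by
    rw [Matrix.mulVec_mulVec, Matrix.nonsing_inv_mul _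
      ((Matrix.isUnit_iff_isUnit_det _).1 (isUnit_inducedMetric hinj)), Matrix.one_mulVec]
  calc _ = ∑ i, ⟪w, fderiv ℝ F p (EuclideanSpace.single i 1)⟫_ℝ *
        ((inducedMetric F p)⁻¹.mulVec ((inducedMetric F p).mulVec c) i) := by
        refine Finset.sum_congr rfl fun i _ => ?_
        conv_rhs => rw [Matrix.mulVec, dotProduct, Finset.mul_sum]
        refine Finset.sum_congr rfl fun j _ => ?_
        rw [hmul j]
        ring
    _ = ⟪w, fderiv ℝ F p c⟫_ℝ := by
        rw [hinvmul, hsum c, inner_sum]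
        refine Finset.sum_congr rfl fun i _ => ?_
        rw [inner_smul_right, mul_comm]
    _ = _ := by
        rw [hc', inner_sub_right, inner_smul_right, real_inner_self_eq_norm_sq, real_inner_comm ν w]
        ring

end Hypersurface

/-! ### Hypersurfaces of the form `|θ| = r (y_{i₀})` -/

section Rotational

open scoped Topology InnerProductSpace

variable {n m k : ℕ}

lemma finrank_splitSpace : Module.finrank ℝ (SplitSpace m k) = m + k + 1 := by
  rw [LinearEquiv.finrank_eq (WithLp.linearEquiv 2 ℝ _)]
  simp
  ring

/-- The projection to the coordinate `y_{i₀}`. -/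
noncomputable def axisCoord (i₀ : Fin k) : SplitSpace m k →L[ℝ] ℝ :=
  (EuclideanSpace.proj i₀).comp (WithLp.sndL 2 ℝ _ _)

lemma axisCoord_apply (i₀ : Fin k) (x : SplitSpace m k) : axisCoord i₀ x = x.snd i₀ := rfl

/-- The projection to the spherical directions. -/
noncomputable def sphereProj : SplitSpace m k →L[ℝ] EuclideanSpace ℝ (Fin (m + 1)) :=
  WithLp.fstL 2 ℝ _ _

lemma sphereProj_apply (x : SplitSpace m k) : sphereProj x = x.fst := rfl

/-- The normal vector `(θ, c e_{i₀})`. -/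
noncomputable def axisNormal (i₀ : Fin k) (θ : EuclideanSpace ℝ (Fin (m + 1))) (c : ℝ) :
    SplitSpace m k := WithLp.toLp 2 (θ, c • EuclideanSpace.single i₀ 1)

lemma inner_axisNormal (i₀ : Fin k) (θ : EuclideanSpace ℝ (Fin (m + 1))) (c : ℝ)
    (x : SplitSpace m k) :
    ⟪axisNormal i₀ θ c, x⟫_ℝ = ⟪θ, sphereProj x⟫_ℝ + c * axisCoord i₀ x := by
  rw [WithLp.prod_inner_apply]
  simp [axisNormal, inner_smul_left, EuclideanSpace.inner_single_left, sphereProj_apply,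
    axisCoord_apply]

lemma norm_sq_axisNormal (i₀ : Fin k) (θ : EuclideanSpace ℝ (Fin (m + 1))) (c : ℝ) :
    ‖axisNormal i₀ θ c‖ ^ 2 = ‖θ‖ ^ 2 + c ^ 2 := by
  rw [WithLp.prod_norm_sq_eq_of_L2]
  simp [axisNormal, norm_smul]

variable {F : EuclideanSpace ℝ (Fin n) → SplitSpace m k} {p : EuclideanSpace ℝ (Fin n)}
  {i₀ : Fin k}

/-- The trace is the sum of the squared lengths of the tangential parts of the `m + 1` unit vectors
spanning the spherical directions. -/
lemma sum_inv_inducedMetric_sphere (hn : n = m + k)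
    (hinj : Function.Injective (fderiv ℝ F p)) {ν : SplitSpace m k} (hν : ν ≠ 0)
    (hort : ∀ v, ⟪ν, fderiv ℝ F p v⟫_ℝ = 0) :
    ∑ i, ∑ j, (inducedMetric F p)⁻¹ i j *
      ⟪sphereProj (fderiv ℝ F p (EuclideanSpace.single i 1)),
        sphereProj (fderiv ℝ F p (EuclideanSpace.single j 1))⟫_ℝ
      = (m + 1) - ‖sphereProj ν‖ ^ 2 / ‖ν‖ ^ 2 := by
  have hdim : Module.finrank ℝ (SplitSpace m k) = n + 1 := by rw [finrank_splitSpace, hn]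
  set e : Fin (m + 1) → SplitSpace m k :=
    fun α => WithLp.toLp 2 (EuclideanSpace.single α 1, 0) with he
  have hinner : ∀ α x, ⟪e α, x⟫_ℝ = sphereProj x α := by
    intro α x
    rw [WithLp.prod_inner_apply]
    simp [he, EuclideanSpace.inner_single_left, sphereProj_apply]
  have hnorm : ∀ α, ‖e α‖ ^ 2 = 1 := by
    intro α
    rw [WithLp.prod_norm_sq_eq_of_L2]
    simp [he]
  have hprod : ∀ x y : SplitSpace m k, ⟪sphereProj x, sphereProj y⟫_ℝ
      = ∑ α, ⟪e α, x⟫_ℝ * ⟪e α, y⟫_ℝ := by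
    intro x y
    rw [PiLp.inner_apply]
    refine Finset.sum_congr rfl fun α _ => ?_
    rw [hinner, hinner, real_inner_eq_re_inner]
    simp [mul_comm]
  have hν' : ∀ α, ⟪ν, e α⟫_ℝ ^ 2 = sphereProj ν α ^ 2 := by
    intro α
    rw [real_inner_comm, hinner]
  simp only [hprod, Finset.mul_sum]
  calc _ = ∑ α, ∑ i, ∑ j, (inducedMetric F p)⁻¹ i j *
      (⟪e α, fderiv ℝ F p (EuclideanSpace.single i 1)⟫_ℝ *
        ⟪e α, fderiv ℝ F p (EuclideanSpace.single j 1)⟫_ℝ) := by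
        rw [Finset.sum_comm (s := (Finset.univ : Finset (Fin (m + 1))))]
        exact Finset.sum_congr rfl fun i _ => Finset.sum_comm
    _ = ∑ α, ((1 : ℝ) - sphereProj ν α ^ 2 / ‖ν‖ ^ 2) := by
        refine Finset.sum_congr rfl fun α _ => ?_
        rw [sum_inv_inducedMetric hdim hinj hν hort, hnorm, hν']
    _ = _ := by
        rw [Finset.sum_sub_distrib, ← Finset.sum_div, EuclideanSpace.real_norm_sq_eq]
        simp

lemma sum_inv_inducedMetric_axis (hn : n = m + k)
    (hinj : Function.Injective (fderiv ℝ F p)) {ν : SplitSpace m k} (hν : ν ≠ 0)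
    (hort : ∀ v, ⟪ν, fderiv ℝ F p v⟫_ℝ = 0) :
    ∑ i, ∑ j, (inducedMetric F p)⁻¹ i j *
      (axisCoord i₀ (fderiv ℝ F p (EuclideanSpace.single i 1)) *
        axisCoord i₀ (fderiv ℝ F p (EuclideanSpace.single j 1)))
      = 1 - axisCoord i₀ ν ^ 2 / ‖ν‖ ^ 2 := by
  have hdim : Module.finrank ℝ (SplitSpace m k) = n + 1 := by rw [finrank_splitSpace, hn]
  have h := sum_inv_inducedMetric hdim hinj hν hort (axisNormal i₀ 0 1)
  have hin : ∀ x : SplitSpace m k, ⟪axisNormal i₀ 0 1, x⟫_ℝ = axisCoord i₀ x := by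
    intro x
    rw [inner_axisNormal]
    simp
  rw [norm_sq_axisNormal, real_inner_comm] at h
  simp only [hin] at h
  simpa using h

/-- Geometry of an immersion into the hypersurface `|θ| = r (y_{i₀})`. -/
theorem rotational_geometry (hn : n = m + k) (hF : ContDiffAt ℝ 2 F p)
    (hinj : Function.Injective (fderiv ℝ F p)) {r r₁ : ℝ → ℝ} {r₂ : ℝ}
    (hlev : ∀ᶠ q in 𝓝 p, ‖sphereProj (F q)‖ ^ 2 = r (axisCoord i₀ (F q)) ^ 2)
    (hr : ∀ᶠ s in 𝓝 (axisCoord i₀ (F p)), HasDerivAt r (r₁ s) s)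
    (hr₁ : HasDerivAt r₁ r₂ (axisCoord i₀ (F p))) (hpos : 0 < r (axisCoord i₀ (F p))) :
    ∃ ν : SplitSpace m k,
      ν = axisNormal i₀ (sphereProj (F p))
        (-(r (axisCoord i₀ (F p)) * r₁ (axisCoord i₀ (F p)))) ∧
      (∀ w, normalPart F p w = (⟪ν, w⟫_ℝ / ‖ν‖ ^ 2) • ν) ∧
      meanCurvatureVector F p = (-(m - r (axisCoord i₀ (F p)) * r₂ /
        (1 + r₁ (axisCoord i₀ (F p)) ^ 2)) / ‖ν‖ ^ 2) • ν := by
  have hdim : Module.finrank ℝ (SplitSpace m k) = n + 1 := by rw [finrank_splitSpace, hn]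
  have hFd : ∀ᶠ q in 𝓝 p, DifferentiableAt ℝ F q :=
    (hF.eventually (by simp)).mono fun q hq => hq.differentiableAt (by norm_num)
  have hcont : ContinuousAt (fun q => axisCoord i₀ (F q)) p :=
    (axisCoord i₀).continuous.continuousAt.comp hF.continuousAt
  -- The derivative of `|θ|² = r(y)²` along the immersion shows that `(θ, -r r' e_{i₀})` is normal.
  -- It is needed on a neighbourhood, since it is differentiated once more below.
  have hortq : ∀ᶠ q in 𝓝 p, ∀ v, ⟪sphereProj (F q), sphereProj (fderiv ℝ F q v)⟫_ℝ
      - (r (axisCoord i₀ (F q)) * r₁ (axisCoord i₀ (F q))) * axisCoord i₀ (fderiv ℝ F q v) = 0 := by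
    filter_upwards [hFd, hlev.eventually_nhds, hcont.eventually hr] with q hq hl hrq v
    have hFq := hq.hasFDerivAt
    have h1 := ((sphereProj (m := m) (k := k)).hasFDerivAt.comp q hFq).norm_sq
    have h2 := (hrq.comp_hasFDerivAt q ((axisCoord (m := m) i₀).hasFDerivAt.comp q hFq)).pow 2
    have h3 := (h1.congr_of_eventuallyEq (hl.mono fun x hx => hx.symm)).unique h2
    have h4 := congrArg (fun T => T v) h3
    simp at h4
    linarith
  set s := axisCoord i₀ (F p) with hs
  set c := r s * r₁ s with hc
  set ν : SplitSpace m k := axisNormal i₀ (sphereProj (F p)) (-c) with hνdef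
  have hort : ∀ v, ⟪ν, fderiv ℝ F p v⟫_ℝ = 0 := by
    intro v
    rw [hνdef, inner_axisNormal]
    linarith [hortq.self_of_nhds v]
  have hlp : ‖sphereProj (F p)‖ ^ 2 = r s ^ 2 := hlev.self_of_nhds
  have hνsq : ‖ν‖ ^ 2 = r s ^ 2 * (1 + r₁ s ^ 2) := by
    rw [hνdef, norm_sq_axisNormal, hlp, hc]; ring
  have hνsq0 : 0 < ‖ν‖ ^ 2 := by rw [hνsq]; positivity
  have hν : ν ≠ 0 := by
    rintro h
    rw [h] at hνsq0
    simp at hνsq0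
  have hnormal := normalPart_eq hdim hinj hν hort
  refine ⟨ν, rfl, hnormal, ?_⟩
  have hF' : HasFDerivAt (fderiv ℝ F) (fderiv ℝ (fderiv ℝ F) p) p :=
    ((hF.fderiv_right (m := 1) (by norm_num)).differentiableAt (by norm_num)).hasFDerivAt
  have hFp := hFd.self_of_nhds.hasFDerivAt
  set c' := r₁ s ^ 2 + r s * r₂ with hc'
  -- Differentiating the orthogonality relation moves the derivative from the tangent vector to the
  -- normal field and expresses the second fundamental form by first derivatives; `c'` is the
  -- derivative of `r r'`.
  have hsecond : ∀ v w, ⟪ν, fderiv ℝ (fderiv ℝ F) p v w⟫_ℝ =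
      -(⟪sphereProj (fderiv ℝ F p v), sphereProj (fderiv ℝ F p w)⟫_ℝ
        - c' * (axisCoord i₀ (fderiv ℝ F p v) * axisCoord i₀ (fderiv ℝ F p w))) := by
    intro v w
    have hw : HasFDerivAt (fun q => fderiv ℝ F q w) ((fderiv ℝ (fderiv ℝ F) p).flip w) p := by
      have := hF'.clm_apply (hasFDerivAt_const w p)
      refine this.congr_fderiv ?_
      ext x
      simp
    have hθ := (sphereProj (m := m) (k := k)).hasFDerivAt.comp p hFp
    have hθw := (sphereProj (m := m) (k := k)).hasFDerivAt.comp p hw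
    have hy := (axisCoord (m := m) i₀).hasFDerivAt.comp p hFp
    have hyw := (axisCoord (m := m) i₀).hasFDerivAt.comp p hw
    have hrr := (hr.self_of_nhds.mul hr₁).comp_hasFDerivAt p hy
    have hz := (hθ.inner ℝ hθw).sub (hrr.mul hyw)
    have h0 := hz.congr_of_eventuallyEq (f₁ := fun _ => (0 : ℝ))
      (hortq.mono fun q hq => (hq w).symm)
    have h1 := h0.unique (hasFDerivAt_const (0 : ℝ) p)
    have h2 := congrArg (fun T => T v) h1
    simp at h2
    rw [hνdef, inner_axisNormal, hc']
    simp only [← hs] at h2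
    linarith
  rw [meanCurvatureVector]
  simp only [hnormal, hsecond, smul_smul]
  rw [← Finset.sum_congr rfl fun i _ => Finset.sum_smul, ← Finset.sum_smul]
  congr 1
  -- Since `|ν|² = r²(1 + r'²)`, the two traces are `m + 1 - 1/(1 + r'²)` and `1/(1 + r'²)`; the
  -- `r'²` terms cancel in the combination.
  have hA := sum_inv_inducedMetric_sphere hn hinj hν hort
  have hB := sum_inv_inducedMetric_axis (i₀ := i₀) hn hinj hν hort
  have hνθ : ‖sphereProj ν‖ ^ 2 = r s ^ 2 := by rw [← hlp]; rfl
  have hνy : axisCoord i₀ ν = -c := by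
    rw [axisCoord_apply, hνdef]; simp [axisNormal]
  rw [hνθ, hνsq] at hA
  rw [hνy, hνsq] at hB
  rw [hνsq]
  calc _ = -((∑ i, ∑ j, (inducedMetric F p)⁻¹ i j *
      ⟪sphereProj (fderiv ℝ F p (EuclideanSpace.single i 1)),
        sphereProj (fderiv ℝ F p (EuclideanSpace.single j 1))⟫_ℝ) -
      c' * ∑ i, ∑ j, (inducedMetric F p)⁻¹ i j *
      (axisCoord i₀ (fderiv ℝ F p (EuclideanSpace.single i 1)) *
        axisCoord i₀ (fderiv ℝ F p (EuclideanSpace.single j 1))))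
        / (r s ^ 2 * (1 + r₁ s ^ 2)) := by
        rw [Finset.mul_sum, ← Finset.sum_sub_distrib, ← Finset.sum_neg_distrib, Finset.sum_div]
        refine Finset.sum_congr rfl fun i _ => ?_
        rw [Finset.mul_sum, ← Finset.sum_sub_distrib, ← Finset.sum_neg_distrib, Finset.sum_div]
        refine Finset.sum_congr rfl fun j _ => ?_
        ring
    _ = _ := by
        rw [hA, hB, hc', hc]
        have h1 : (1 : ℝ) + r₁ s ^ 2 ≠ 0 := by positivity
        have h2 : r s ≠ 0 := hpos.ne'
        congr 1
        field_simp
        ring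

end Rotational

/-! ### Graphs over the cylinder -/

section Graph

open scoped Topology InnerProductSpace

variable {n m k : ℕ} {i₀ : Fin k}

/-- The inclusion of the spherical directions. -/
noncomputable def sphereIncl : EuclideanSpace ℝ (Fin (m + 1)) →L[ℝ] SplitSpace m k :=
  (WithLp.prodContinuousLinearEquiv 2 ℝ (EuclideanSpace ℝ (Fin (m + 1)))
    (EuclideanSpace ℝ (Fin k))).symm.toContinuousLinearMap.comp (ContinuousLinearMap.inl ℝ _ _)

lemma cylNormal_eq (x : SplitSpace m k) :
    cylNormal x = sphereIncl (‖sphereProj x‖⁻¹ • sphereProj x) := rfl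

lemma sphereProj_sphereIncl (θ : EuclideanSpace ℝ (Fin (m + 1))) :
    sphereProj (sphereIncl θ : SplitSpace m k) = θ := rfl

lemma snd_sphereIncl (θ : EuclideanSpace ℝ (Fin (m + 1))) :
    (sphereIncl θ : SplitSpace m k).snd = 0 := rfl

lemma axisCoord_cylNormal (x : SplitSpace m k) : axisCoord i₀ (cylNormal x) = 0 := by
  rw [axisCoord_apply, cylNormal_eq, snd_sphereIncl]
  rfl

lemma snd_normalGraph (u : SplitSpace m k → ℝ → ℝ) (x : SplitSpace m k) (τ : ℝ) :
    WithLp.sndL 2 ℝ _ _ (normalGraph u x τ) = WithLp.sndL 2 ℝ _ _ x := by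
  have h : WithLp.sndL 2 ℝ _ _ (cylNormal x) = 0 := rfl
  rw [normalGraph, map_add, map_smul, h, smul_zero, add_zero]

lemma axisCoord_normalGraph (u : SplitSpace m k → ℝ → ℝ) (x : SplitSpace m k) (τ : ℝ) :
    axisCoord i₀ (normalGraph u x τ) = axisCoord i₀ x := by
  rw [normalGraph, map_add, map_smul, axisCoord_cylNormal, smul_zero, add_zero]

lemma sphereProj_normalGraph (u : SplitSpace m k → ℝ → ℝ) (x : SplitSpace m k) (τ : ℝ)
    (hx : x ∈ roundCylinder m k) :
    sphereProj (normalGraph u x τ) = (1 + u x τ * (cylRadius m)⁻¹) • sphereProj x := by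
  have hx' : ‖sphereProj x‖ = cylRadius m := hx
  rw [normalGraph, map_add, map_smul, cylNormal_eq, sphereProj_sphereIncl, hx', add_smul, one_smul,
    mul_smul]

lemma contDiffAt_cylNormal {x : SplitSpace m k} (hx : sphereProj x ≠ 0) :
    ContDiffAt ℝ ∞ (cylNormal : SplitSpace m k → SplitSpace m k) x := by
  have h1 : ContDiffAt ℝ ∞ (fun x : SplitSpace m k => sphereProj x) x :=
    sphereProj.contDiff.contDiffAt
  have h2 : ContDiffAt ℝ ∞ (fun x : SplitSpace m k => ‖sphereProj x‖⁻¹) x :=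
    (h1.norm ℝ hx).inv (norm_ne_zero_iff.2 hx)
  exact sphereIncl.contDiff.contDiffAt.comp x (h2.smul h1)

lemma deriv_const_add_smul {E : Type*} [NormedAddCommGroup E] [InnerProductSpace ℝ E] {f : ℝ → ℝ}
    {f' τ : ℝ} (hf : HasDerivAt f f' τ) (x v : E) : deriv (fun s => x + f s • v) τ = f' • v :=
  ((hf.smul_const v).const_add x).deriv

/-! ### Graphs of functions of one axial coordinate -/

/-- The normal graph of a function of one axial coordinate. -/
noncomputable def axisGraph (i₀ : Fin k) (U : ℝ × ℝ → ℝ) : SplitSpace m k → ℝ → SplitSpace m k :=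
  normalGraph fun x τ => U (axisCoord i₀ x, τ)

lemma cylRadius_pos (hm : 1 ≤ m) : 0 < cylRadius m := by
  have : (0 : ℝ) < m := by exact_mod_cast hm
  exact Real.sqrt_pos.2 (by positivity)

lemma axisCoord_axisGraph (U : ℝ × ℝ → ℝ) (x : SplitSpace m k) (τ : ℝ) :
    axisCoord i₀ (axisGraph i₀ U x τ) = axisCoord i₀ x :=
  axisCoord_normalGraph _ _ _

lemma sphereProj_axisGraph (hm : 1 ≤ m) (U : ℝ × ℝ → ℝ) {x : SplitSpace m k} (τ : ℝ)
    (hx : x ∈ roundCylinder m k) :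
    sphereProj (axisGraph i₀ U x τ) =
      ((cylRadius m + U (axisCoord i₀ x, τ)) * (cylRadius m)⁻¹) • sphereProj x := by
  have := cylRadius_pos hm
  rw [axisGraph, sphereProj_normalGraph _ _ _ hx, add_mul, mul_inv_cancel₀ this.ne']

section Profile

variable {O : Set (ℝ × ℝ)} {U U_y U_yy U_t : ℝ × ℝ → ℝ}
  {ψ : EuclideanSpace ℝ (Fin n) → SplitSpace m k} {W : Set (EuclideanSpace ℝ (Fin n))}
  {p : EuclideanSpace ℝ (Fin n)} {τ : ℝ}

namespace IsGraphProfile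

lemma contDiffAt_axisGraph (hm : 1 ≤ m) (hU : IsGraphProfile m O U U_y U_yy U_t)
    (hψ : IsLocalParam (roundCylinder m k) ψ W) (hp : p ∈ W)
    (hO : (axisCoord i₀ (ψ p), τ) ∈ O) :
    ContDiffAt ℝ ∞ (fun z : EuclideanSpace ℝ (Fin n) × ℝ => axisGraph i₀ U (ψ z.1) z.2)
      (p, τ) := by
  have h1 : ContDiffAt ℝ ∞ (fun z : EuclideanSpace ℝ (Fin n) × ℝ => ψ z.1) (p, τ) :=
    (hψ.smooth.contDiffAt (hψ.isOpen.mem_nhds hp)).comp (p, τ) contDiffAt_fst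
  have h2 : ContDiffAt ℝ ∞
      (fun z : EuclideanSpace ℝ (Fin n) × ℝ => (axisCoord i₀ (ψ z.1), z.2)) (p, τ) :=
    ((axisCoord i₀).contDiff.contDiffAt.comp (p, τ) h1).prodMk contDiffAt_snd
  have h3 : ContDiffAt ℝ ∞
      (fun z : EuclideanSpace ℝ (Fin n) × ℝ => U (axisCoord i₀ (ψ z.1), z.2)) (p, τ) :=
    ContDiffAt.comp (p, τ) (g := U) (hU.contDiffOn.contDiffAt (hU.isOpen.mem_nhds hO)) h2
  have hne : sphereProj (ψ p) ≠ 0 := by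
    have : ‖sphereProj (ψ p)‖ = cylRadius m := hψ.mapsTo hp
    exact norm_ne_zero_iff.1 (by rw [this]; exact (cylRadius_pos hm).ne')
  have h4 : ContDiffAt ℝ ∞ (fun z : EuclideanSpace ℝ (Fin n) × ℝ => cylNormal (ψ z.1)) (p, τ) :=
    ContDiffAt.comp (p, τ) (g := cylNormal) (contDiffAt_cylNormal hne) h1
  exact h1.add (h3.smul h4)

lemma contDiffAt_axisGraph_slice (hm : 1 ≤ m) (hU : IsGraphProfile m O U U_y U_yy U_t)
    (hψ : IsLocalParam (roundCylinder m k) ψ W) (hp : p ∈ W)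
    (hO : (axisCoord i₀ (ψ p), τ) ∈ O) :
    ContDiffAt ℝ ∞ (fun q => axisGraph i₀ U (ψ q) τ) p :=
  ContDiffAt.comp p (f := fun q : EuclideanSpace ℝ (Fin n) => (q, τ))
    (hU.contDiffAt_axisGraph hm hψ hp hO) (contDiffAt_id.prodMk contDiffAt_const)

/-- The graph map fixes `y` and rescales `θ` by a positive factor depending on `y_{i₀}` and `τ`. A
vector in the kernel has zero `y`-part, so the derivative of the factor drops out and its `θ`-part
vanishes as well. -/
lemma injective_fderiv_axisGraph (hm : 1 ≤ m) (hU : IsGraphProfile m O U U_y U_yy U_t)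
    (hψ : IsLocalParam (roundCylinder m k) ψ W) (hp : p ∈ W)
    (hO : (axisCoord i₀ (ψ p), τ) ∈ O) :
    Function.Injective (fderiv ℝ (fun q => axisGraph i₀ U (ψ q) τ) p) := by
  have hρ0 := cylRadius_pos hm
  have hψd : HasFDerivAt ψ (fderiv ℝ ψ p) p :=
    ((hψ.smooth.contDiffAt (hψ.isOpen.mem_nhds hp)).differentiableAt (by simp)).hasFDerivAt
  have hFd :=
    ((hU.contDiffAt_axisGraph_slice hm hψ hp hO).differentiableAt (by simp)).hasFDerivAt
  refine (injective_iff_map_eq_zero _).2 fun v hv => ?_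
  have hsnd : WithLp.sndL 2 ℝ _ _ (fderiv ℝ ψ p v) = 0 := by
    have h1 := (WithLp.sndL 2 ℝ (EuclideanSpace ℝ (Fin (m + 1)))
      (EuclideanSpace ℝ (Fin k))).hasFDerivAt.comp p hFd
    have h2 := (WithLp.sndL 2 ℝ (EuclideanSpace ℝ (Fin (m + 1)))
      (EuclideanSpace ℝ (Fin k))).hasFDerivAt.comp p hψd
    have h3 := (h2.congr_of_eventuallyEq
      (Filter.Eventually.of_forall fun q => snd_normalGraph _ (ψ q) τ)).unique h1
    have h4 := congrArg (fun T => T v) h3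
    simp only [ContinuousLinearMap.comp_apply, hv, map_zero] at h4
    exact h4
  have haxis : axisCoord i₀ (fderiv ℝ ψ p v) = 0 := by
    change EuclideanSpace.proj i₀ (WithLp.sndL 2 ℝ _ _ (fderiv ℝ ψ p v)) = 0
    rw [hsnd, map_zero]
  have hfst : sphereProj (fderiv ℝ ψ p v) = 0 := by
    have h1 := (sphereProj (m := m) (k := k)).hasFDerivAt.comp p hFd
    have hy : HasFDerivAt (fun q => (axisCoord i₀ (ψ q), τ))
        (((axisCoord i₀).comp (fderiv ℝ ψ p)).prod 0) p :=
      ((axisCoord (m := m) i₀).hasFDerivAt.comp p hψd).prodMk (hasFDerivAt_const τ p)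
    have hUq := HasFDerivAt.comp (g := U) p (hU.hasFDerivAt _ hO) hy
    have h2 := ((hUq.const_add (cylRadius m)).mul_const (cylRadius m)⁻¹).smul
      ((sphereProj (m := m) (k := k)).hasFDerivAt.comp p hψd)
    have h3 := (h2.congr_of_eventuallyEq (Filter.eventually_of_mem (hψ.isOpen.mem_nhds hp)
      fun q hq => sphereProj_axisGraph hm U τ (hψ.mapsTo hq))).unique h1
    have h4 := congrArg (fun T => T v) h3
    have h5 := hU.lt _ hO
    have h6 : cylRadius m + U (axisCoord i₀ (ψ p), τ) ≠ 0 := by linarith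
    simpa [hv, haxis, hρ0.ne', h6] using h4
  have hzero : fderiv ℝ ψ p v = 0 := WithLp.ofLp_injective 2 (Prod.ext hfst hsnd)
  exact hψ.immersion p hp (hzero.trans (map_zero _).symm)

lemma hasDerivAt_snd (hU : IsGraphProfile m O U U_y U_yy U_t) {s : ℝ} (hO : (s, τ) ∈ O) :
    HasDerivAt (fun t => U (s, t)) (U_t (s, τ)) τ := by
  have h1 : HasDerivAt (fun t : ℝ => (s, t)) ((0 : ℝ), (1 : ℝ)) τ :=
    (hasDerivAt_const τ s).prodMk (hasDerivAt_id τ)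
  refine (HasFDerivAt.comp_hasDerivAt τ (hU.hasFDerivAt _ hO) h1).congr_deriv ?_
  simp

lemma hasDerivAt_fst (hU : IsGraphProfile m O U U_y U_yy U_t) {s : ℝ} (hO : (s, τ) ∈ O) :
    HasDerivAt (fun y => cylRadius m + U (y, τ)) (U_y (s, τ)) s := by
  have h1 : HasDerivAt (fun y : ℝ => (y, τ)) ((1 : ℝ), (0 : ℝ)) s :=
    (hasDerivAt_id s).prodMk (hasDerivAt_const s τ)
  have h2 : HasDerivAt (fun y : ℝ => U (y, τ)) (U_y (s, τ)) s := by
    refine (HasFDerivAt.comp_hasDerivAt s (hU.hasFDerivAt _ hO) h1).congr_deriv ?_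
    simp
  exact h2.const_add _

lemma normalPart_deriv_axisGraph (hn : n = m + k) (hm : 1 ≤ m)
    (hU : IsGraphProfile m O U U_y U_yy U_t)
    (hψ : IsLocalParam (roundCylinder m k) ψ W) (hp : p ∈ W)
    (hO : (axisCoord i₀ (ψ p), τ) ∈ O) :
    normalPart (fun q => axisGraph i₀ U (ψ q) τ) p (deriv (fun s => axisGraph i₀ U (ψ p) s) τ) =
      meanCurvatureVector (fun q => axisGraph i₀ U (ψ q) τ) p +
        (1 / 2 : ℝ) • normalPart (fun q => axisGraph i₀ U (ψ q) τ) p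
          (axisGraph i₀ U (ψ p) τ) := by
  have hρ0 := cylRadius_pos hm
  have hgt := hU.lt _ hO
  have hpde := hU.equation _ hO
  have hnormψ : ∀ q ∈ W, ‖sphereProj (ψ q)‖ = cylRadius m := fun q hq => hψ.mapsTo hq
  have hμ : ∀ q ∈ W, sphereProj (axisGraph i₀ U (ψ q) τ) = _ := fun q hq =>
    sphereProj_axisGraph hm U τ (hψ.mapsTo hq)
  have hnormF : ∀ q ∈ W, ‖sphereProj (axisGraph i₀ U (ψ q) τ)‖ ^ 2
      = (cylRadius m + U (axisCoord i₀ (ψ q), τ)) ^ 2 := by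
    intro q hq
    rw [hμ q hq, norm_smul, hnormψ q hq, Real.norm_eq_abs, mul_pow, sq_abs]
    field_simp
  have hc : ContinuousAt (fun s : ℝ => (s, τ)) (axisCoord i₀ (ψ p)) := by fun_prop
  obtain ⟨ν, hν, hnormal, hH⟩ := rotational_geometry (i₀ := i₀)
    (F := fun q => axisGraph i₀ U (ψ q) τ) (p := p) (r := fun s => cylRadius m + U (s, τ))
    (r₁ := fun s => U_y (s, τ)) (r₂ := U_yy (axisCoord i₀ (ψ p), τ)) hn
    ((hU.contDiffAt_axisGraph_slice hm hψ hp hO).of_le (by norm_cast))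
    (hU.injective_fderiv_axisGraph hm hψ hp hO)
    (Filter.eventually_of_mem (hψ.isOpen.mem_nhds hp) fun q hq => by
      rw [axisCoord_axisGraph]; exact hnormF q hq)
    (by
      rw [axisCoord_axisGraph]
      exact Filter.eventually_of_mem (hc.preimage_mem_nhds (hU.isOpen.mem_nhds hO))
        fun s hs => hU.hasDerivAt_fst hs)
    (by rw [axisCoord_axisGraph]; exact hU.hasDerivAt _ hO)
    (by rw [axisCoord_axisGraph]; linarith)
  simp only [axisCoord_axisGraph] at hν hH
  have htime : deriv (fun s => axisGraph i₀ U (ψ p) s) τ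
      = U_t (axisCoord i₀ (ψ p), τ) • cylNormal (ψ p) :=
    deriv_const_add_smul (hU.hasDerivAt_snd hO) (ψ p) (cylNormal (ψ p))
  rw [htime, hnormal, hnormal, hH, smul_smul, ← add_smul]
  -- Both sides are multiples of `ν`. Up to the common factor `‖ν‖⁻²`, the coefficients agree when
  -- `r u_τ = -(m - r u_yy/(1 + u_y²)) + (r² - r y u_y)/2`, which is the profile equation multiplied
  -- by `r`.
  congr 1
  set s := axisCoord i₀ (ψ p) with hs
  set r := cylRadius m + U (s, τ) with hr
  have hr0 : r ≠ 0 := by rw [hr]; linarith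
  have hin1 : ⟪ν, U_t (s, τ) • cylNormal (ψ p)⟫_ℝ = U_t (s, τ) * r := by
    rw [inner_smul_right, hν, inner_axisNormal, axisCoord_cylNormal, cylNormal_eq,
      sphereProj_sphereIncl, hμ p hp, hnormψ p hp, real_inner_smul_left, real_inner_smul_right,
      real_inner_self_eq_norm_sq, hnormψ p hp, mul_zero, add_zero]
    field_simp
    rfl
  have hin2 : ⟪ν, axisGraph i₀ U (ψ p) τ⟫_ℝ = r ^ 2 - r * U_y (s, τ) * s := by
    rw [hν, inner_axisNormal, axisCoord_axisGraph, real_inner_self_eq_norm_sq, hnormF p hp]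
    ring
  rw [hin1, hin2, hpde]
  have h1 : (1 : ℝ) + U_y (s, τ) ^ 2 ≠ 0 := by positivity
  have h3 : r * ((1 + U_y (s, τ) ^ 2) * (U_t (s, τ) + m / r - r / 2 + s * U_y (s, τ) / 2))
      / (1 + U_y (s, τ) ^ 2) = r * U_t (s, τ) + m - r ^ 2 / 2 + r * U_y (s, τ) * s / 2 := by
    field_simp
  rw [h3]
  ring

/-- A solution of the graph equation in one variable gives a rescaled mean curvature flow. -/
theorem isRescaledMCF (hn : n = m + k) (hm : 1 ≤ m) (hU : IsGraphProfile m O U U_y U_yy U_t) :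
    IsRescaledMCF n (roundCylinder m k) {w | (axisCoord i₀ w.1, w.2) ∈ O} (axisGraph i₀ U) :=
  ⟨fun _ _ hψ _ hp _ hO => hU.contDiffAt_axisGraph hm hψ hp hO,
    fun _ _ hψ _ hp _ hO => hU.injective_fderiv_axisGraph hm hψ hp hO,
    fun _ _ hψ _ hp _ hO => hU.normalPart_deriv_axisGraph hn hm hψ hp hO⟩

end IsGraphProfile

end Profile

end Graph

/-! ### The flow over the full cylinder -/

theorem corollary1p4 (n k N : ℕ) (hk : 1 ≤ k) (hkn : k < n) (hN : 1 ≤ N) :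
    ∃ (O : Set (SplitSpace (n - k) k × ℝ)) (u : SplitSpace (n - k) k → ℝ → ℝ),
      -- `u` is defined on (a neighbourhood of) the region `|y| ≤ e^{∘N}(τ)`, `0 ≤ τ < ∞`
      IsOpen O ∧
      (∀ x ∈ roundCylinder (n - k) k, ∀ τ : ℝ, 0 ≤ τ → ‖x.snd‖ ≤ iterExp N τ → (x, τ) ∈ O) ∧
      -- the graph stays in the tubular neighbourhood of the cylinder
      (∀ x ∈ roundCylinder (n - k) k, ∀ τ : ℝ, (x, τ) ∈ O → -cylRadius (n - k) < u x τ) ∧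
      -- the normal graphs of `u` form a rescaled mean curvature flow
      IsRescaledMCF n (roundCylinder (n - k) k) O (normalGraph u) ∧
      -- nontriviality, at every time, already over the central sphere `y = 0`
      (∀ τ : ℝ, 0 ≤ τ → ∃ x ∈ roundCylinder (n - k) k, x.snd = 0 ∧ u x τ ≠ 0) ∧
      -- `|u| e^{∘N}(τ) → 0` as `τ → ∞`, uniformly on the region
      (∀ ε : ℝ, 0 < ε → ∃ T : ℝ, 0 ≤ T ∧ ∀ τ : ℝ, T ≤ τ →
        ∀ x ∈ roundCylinder (n - k) k, ‖x.snd‖ ≤ iterExp N τ → |u x τ| * iterExp N τ < ε) := by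
  have hm : 1 ≤ n - k := by omega
  obtain ⟨O, U, U_y, U_yy, U_t, hU, hreg, hne, hlim⟩ := exists_profile (n - k) N hm
  let i₀ : Fin k := ⟨0, hk⟩
  -- The solution is constant in the remaining axial directions, and `|y_{i₀}| ≤ |y|` places the
  -- required region inside the region of the profile.
  have hcoord : ∀ x : SplitSpace (n - k) k, |axisCoord i₀ x| ≤ ‖x.snd‖ := fun x =>
    PiLp.norm_apply_le x.snd i₀
  refine ⟨{w | (axisCoord i₀ w.1, w.2) ∈ O}, fun x τ => U (axisCoord i₀ x, τ), ?_, ?_, ?_,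
    hU.isRescaledMCF (by omega) hm, ?_, ?_⟩
  · exact hU.isOpen.preimage
      (((axisCoord i₀).continuous.comp continuous_fst).prodMk continuous_snd)
  · exact fun x _ τ hτ hx => hreg _ _ hτ ((hcoord x).trans hx)
  · exact fun x _ τ hx => hU.lt _ hx
  · intro τ _
    refine ⟨sphereIncl (EuclideanSpace.single 0 (cylRadius (n - k))), ?_, snd_sphereIncl _, ?_⟩
    · change ‖EuclideanSpace.single (0 : Fin (n - k + 1)) (cylRadius (n - k))‖ = _
      rw [PiLp.norm_single, Real.norm_of_nonneg (cylRadius_pos hm).le]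
    · exact hne τ
  · intro ε hε
    obtain ⟨T, hT, h⟩ := hlim ε hε
    exact ⟨T, hT, fun τ hτ x _ hx => h τ hτ _ ((hcoord x).trans hx)⟩
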